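/- Let $\Omega$ be the open unit ball of $\mathbf R^n$, with coordinates $y^a$, and let $d(y)=1-|y|$. Let $x:\overline\Omega\to\mathbf R^n$ be smooth up to the boundary, with $\partial x/\partial y$ invertible everywhere and $|\partial x/\partial y|^2+|\partial y/\partial x|^2\le c_1^2$ on $\overline\Omega$, where $\partial y/\partial x$ is the inverse matrix. Let $g_{ab}=\delta_{ij}\frac{\partial x^i}{\partial y^a}\frac{\partial x^j}{\partial y^b}$, let $g^{ab}$ be its inverse, $\kappa=\sqrt{\det g}$, $\triangle q=\kappa^{-1}\partial_a(\kappa g^{ab}\partial_b q)$, and $[g]_1=1+\sup_\Omega|\partial g|$, where $\partial=\partial_y$. Let $N$ be the exterior unit normal of $\partial\Omega$ in the metric $g$ and $\nabla_N=N^a\partial_a$. Let $p$ be smooth on $\overline\Omega$ (up to the boundary) with $p=0$ on $\partial\Omega$. The normal operator $A$ is defined on vector fields $W$ that are smooth on $\overline\Omega$ by $$(AW)^a=-g^{ab}\partial_b\big((\partial_c p)W^c-q\big),\qquad \triangle\big((\partial_c p)W^c-q\big)=0\ \text{ in }\Omega,\qquad q|_{\partial\Omega}=0,$$ that is, $AW$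 is the orthogonal projection of $-g^{ab}\partial_b((\partial_cp)W^c)$ onto the divergence free vector fields in the inner product $\int_\Omega g_{ab}U^aW^b\kappa\,dy$. Let $w_a=g_{ab}W^b$, $(\operatorname{curl}w)_{ab}=\partial_aw_b-\partial_bw_a$, $\operatorname{div}W=\kappa^{-1}\partial_a(\kappa W^a)$, let $(\partial W)_a{}^b=\partial_aW^b$, and let $\|\cdot\|$ be the norm of $L^2(\Omega,dy)$ of the components. Let $\mathcal S=\mathcal S_0\cup\mathcal S_1$, where $\mathcal S_0$ consists of the rotations $y^a\partial_b-y^b\partial_a$, $a<b$, and $\mathcal S_1$ is a finite set of smooth vector fields with $\partial_aS^a=0$ that vanish where $d\le d_0/2$ and span the tangent space at every point where $d\ge d_0$, for some $0<d_0<1$. Lemma 5.4. Let $c_0>0$ be a constant such that $|\nabla_Np|\ge c_0$ on $\partial\Omega$, and let $K_2,K_3$ be constants such that $\|\nabla_Np\|_{L^\infty(\partial\Omega)}\le K_2$ and $\sum_{S\in\mathcal S}\|\nabla_N(Sp)\|_{L^\infty(\partial\Omega)}\le K_3$. Then for every vector field $W$ that is smooth on $\overline\Omega$, $$c_0\|\partial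 W\|\le C\big(\|AW\|+K_2(\|\operatorname{curl}w\|+\|\operatorname{div}W\|)+(K_3+K_2[g]_1)\|W\|\big),$$ where $C$ depends only on $n$ and $c_1$. In particular $$c_0\|\partial W\|\le C\max(1,K_2)\big(\|AW\|+K_2(\|\operatorname{curl}w\|+\|\operatorname{div}W\|)+(K_3+[g]_1)\|W\|\big).$$ -/

import Mathlib

open MeasureTheory Metric
open scoped ContDiff Matrix

noncomputable section

namespace EulerLagrangian

/-- Points, and component vectors, of `ℝⁿ` with the Euclidean norm. -/
abbrev Vec (n : ℕ) := EuclideanSpace ℝ (Fin n)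

variable {n : ℕ}

/-- The Lagrangian reference domain `Ω`: the open unit ball. -/
abbrev Om (n : ℕ) : Set (Vec n) := ball 0 1

/-- The closure of `Ω`. -/
abbrev OmBar (n : ℕ) : Set (Vec n) := closedBall 0 1

/-- The boundary of `Ω`. -/
abbrev bdry (n : ℕ) : Set (Vec n) := sphere 0 1

/-- Functions that are smooth on `Ω`, up to the boundary. -/
def SmoothUpTo {F : Type*} [NormedAddCommGroup F] [NormedSpace ℝ F] (f : Vec n → F) : Prop :=
  ContDiffOn ℝ ∞ f (OmBar n)

/-- The partial derivative `∂_a f = ∂f/∂y^a`, up to the boundary of `Ω`. -/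
def pd (f : Vec n → ℝ) (a : Fin n) (y : Vec n) : ℝ :=
  fderivWithin ℝ f (OmBar n) y (EuclideanSpace.single a 1)

/-! ### The metric -/

/-- The Jacobian matrix `∂x^i/∂y^a` (row `i`, column `a`). -/
def jac (x : Vec n → Vec n) (y : Vec n) : Matrix (Fin n) (Fin n) ℝ :=
  Matrix.of fun i a => pd (fun z => x z i) a y

/-- The metric `g_ab = δ_ij (∂x^i/∂y^a) (∂x^j/∂y^b)`. -/
def metric (x : Vec n → Vec n) (y : Vec n) : Matrix (Fin n) (Fin n) ℝ :=
  (jac x y)ᵀ * jac x y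

/-- The volume density `κ = √(det g)`. -/
def kap (x : Vec n → Vec n) (y : Vec n) : ℝ := Real.sqrt (metric x y).det

/-- The coordinate condition: `∂x/∂y` is invertible on the closed ball and
`|∂x/∂y|² + |∂y/∂x|² ≤ c₁²` there. -/
def CoordinateCondition (x : Vec n → Vec n) (c₁ : ℝ) : Prop :=
  ∀ y ∈ OmBar n, (jac x y).det ≠ 0 ∧
    (∑ i, ∑ a, (jac x y i a) ^ 2) + (∑ a, ∑ i, ((jac x y)⁻¹ a i) ^ 2) ≤ c₁ ^ 2

/-- `[g]₁ = 1 + sup_Ω |∂g|`. -/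
def metricBracket (x : Vec n → Vec n) : ℝ :=
  1 + ⨆ y : OmBar n,
    Real.sqrt (∑ c, ∑ a, ∑ b, (pd (fun z => metric x z a b) c (y : Vec n)) ^ 2)

/-! ### Differential operators on functions and vector fields in the Lagrangian frame -/

/-- The derivative `S f = S^a ∂_a f` of a function along a vector field. -/
def along (S : Vec n → Vec n) (f : Vec n → ℝ) (y : Vec n) : ℝ :=
  ∑ a, S y a * pd f a y

/-- The gradient vector field `g^{ab} ∂_b f`. -/
def grad (x : Vec n → Vec n) (f : Vec n → ℝ) (y : Vec n) : Vec n :=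
  WithLp.toLp 2 ((metric x y)⁻¹ *ᵥ fun b => pd f b y)

/-- The one form `w_a = g_ab W^b`. -/
def lower (x : Vec n → Vec n) (W : Vec n → Vec n) (y : Vec n) : Vec n :=
  WithLp.toLp 2 (metric x y *ᵥ fun b => W y b)

/-- `(∂W)_a^b = ∂_a W^b`. -/
def partials (W : Vec n → Vec n) (y : Vec n) : Matrix (Fin n) (Fin n) ℝ :=
  Matrix.of fun a b => pd (fun z => W z b) a y

/-- `(curl w)_ab = ∂_a w_b - ∂_b w_a` for a one form `w`. -/
def curl (w : Vec n → Vec n) (y : Vec n) : Matrix (Fin n) (Fin n) ℝ :=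
  Matrix.of fun a b => pd (fun z => w z b) a y - pd (fun z => w z a) b y

/-- `div W = κ⁻¹ ∂_a (κ W^a)`. -/
def divergence (x : Vec n → Vec n) (W : Vec n → Vec n) (y : Vec n) : ℝ :=
  (kap x y)⁻¹ * ∑ a, pd (fun z => kap x z * W z a) a y

/-- The exterior unit conormal `n_a` at a boundary point: the multiple of `-∂_a d`, where
`d = 1 - |y|`, of length one in the metric `g`. On the boundary `-∂_a d = y^a`. -/
def conormal (x : Vec n → Vec n) (y : Vec n) : Fin n → ℝ :=
  fun a => y a / Real.sqrt (∑ b, ∑ c, (metric x y)⁻¹ b c * y b * y c)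

/-- The normal derivative `∇_N f = g^{ab} n_b ∂_a f` at a boundary point. -/
def normalDeriv (x : Vec n → Vec n) (f : Vec n → ℝ) (y : Vec n) : ℝ :=
  ∑ a, ((metric x y)⁻¹ *ᵥ conormal x y) a * pd f a y

/-! ### Norms -/

/-- The norm in `L^∞(∂Ω)` of a continuous function on the boundary. -/
def supBdry (f : Vec n → ℝ) : ℝ := ⨆ y : bdry n, |f (y : Vec n)|

/-- The norm of a function in `L²(Ω)`. -/
def normFun (f : Vec n → ℝ) : ℝ := Real.sqrt (∫ y in Om n, (f y) ^ 2)

/-- The norm of a vector field in `L²(Ω)`. -/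
def normVec (W : Vec n → Vec n) : ℝ := Real.sqrt (∫ y in Om n, ∑ a, (W y a) ^ 2)

/-- The norm of a field of matrices in `L²(Ω)`. -/
def normMat (T : Vec n → Matrix (Fin n) (Fin n) ℝ) : ℝ :=
  Real.sqrt (∫ y in Om n, ∑ a, ∑ b, (T y a b) ^ 2)

/-! ### The tangential vector fields -/

/-- The rotation `y^a ∂_b - y^b ∂_a`. -/
def rotation (a b : Fin n) (y : Vec n) : Vec n :=
  y a • EuclideanSpace.single b 1 - y b • EuclideanSpace.single a 1

/-- A finite set `𝒮₁` of smooth vector fields with `∂_a S^a = 0` that vanish at distance at most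
`d₀ / 2` from the boundary and span the tangent space at distance at least `d₀`. -/
def IsInteriorFamily (d₀ : ℝ) (S₁ : Finset (Vec n → Vec n)) : Prop :=
  (∀ S ∈ S₁, ContDiff ℝ ∞ S ∧
    (∀ y, ∑ a, fderiv ℝ (fun z => S z a) y (EuclideanSpace.single a 1) = 0) ∧
    (∀ y, 1 - ‖y‖ ≤ d₀ / 2 → S y = 0)) ∧
  ∀ y, d₀ ≤ 1 - ‖y‖ → Submodule.span ℝ {v | ∃ S ∈ S₁, S y = v} = ⊤

open Classical in
/-- The set `𝒮 = 𝒮₀ ∪ 𝒮₁` of tangential vector fields, `𝒮₀` being the set of the rotations. -/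
def tangential (S₁ : Finset (Vec n → Vec n)) : Finset (Vec n → Vec n) :=
  ((Finset.univ.filter fun ab : Fin n × Fin n => ab.1 < ab.2).image
    fun ab => rotation ab.1 ab.2) ∪ S₁

/-! ### The projection onto divergence free vector fields and the normal operator -/

/-- The measure `κ dy` on `Ω`. -/
def vol (x : Vec n → Vec n) : Measure (Vec n) :=
  (volume.restrict (Om n)).withDensity fun y => ENNReal.ofReal (kap x y)

/-- The Eulerian components `u^i = (∂x^i/∂y^a) U^a` of a vector field `U`. -/
def toEuler (x : Vec n → Vec n) (U : Vec n → Vec n) (y : Vec n) : Vec n :=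
  WithLp.toLp 2 (jac x y *ᵥ fun a => U y a)

/-- The Lagrangian components `U^a = (∂y^a/∂x^i) u^i` of a vector field with Eulerian
components `u`. -/
def toLagrange (x : Vec n → Vec n) (u : Vec n → Vec n) (y : Vec n) : Vec n :=
  WithLp.toLp 2 ((jac x y)⁻¹ *ᵥ fun i => u y i)

/-- The Hilbert space of square integrable vector fields with the inner product
`⟨U, W⟩ = ∫_Ω g_ab U^a W^b κ dy`, a field being represented by its Eulerian components, in which
`g_ab U^a W^b` is the Euclidean inner product. -/
abbrev FieldSpace (x : Vec n → Vec n) := Lp (Vec n) 2 (vol x)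

open Classical in
/-- The element of the Hilbert space that a vector field `U` defines (zero if `U` is not square
integrable). -/
def toField (x : Vec n → Vec n) (U : Vec n → Vec n) : FieldSpace x :=
  if h : MemLp (toEuler x U) 2 (vol x) then h.toLp (toEuler x U) else 0

/-- Test functions on `Ω`. -/
def IsTest (φ : Vec n → ℝ) : Prop :=
  ContDiff ℝ ∞ φ ∧ HasCompactSupport φ ∧ tsupport φ ⊆ Om n

/-- The space of the gradients `g^{ab} ∂_b φ` of test functions. Its closure consists of the
gradients of the functions in `H¹` that vanish on the boundary. -/
def gradientFields (x : Vec n → Vec n) : Submodule ℝ (FieldSpace x) :=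
  Submodule.span ℝ {F | ∃ φ, IsTest φ ∧ F = toField x (grad x φ)}

/-- The space of the divergence free vector fields: those `U` for which
`⟨U, g^{-1} ∂φ⟩ = ∫_Ω U^a ∂_a φ κ dy` is zero for all test functions `φ`. -/
abbrev divFreeFields (x : Vec n → Vec n) : Submodule ℝ (FieldSpace x) :=
  (gradientFields x)ᗮ

/-- The orthogonal projection `P` onto the divergence free vector fields. Thus
`P U = U - g^{-1} ∂q`, where `q` is the solution of the Dirichlet problem `Δ q = div U` in `Ω`,
`q = 0` on the boundary. -/
def proj (x : Vec n → Vec n) : FieldSpace x →L[ℝ] FieldSpace x :=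
  (divFreeFields x).starProjection

/-- The normal operator `A W = P (- g^{-1} ∂((∂_c p) W^c))`. Thus
`A W = - g^{-1} ∂((∂_c p) W^c - q)`, where `q` is such that `Δ((∂_c p) W^c - q) = 0` in `Ω` and
`q = 0` on the boundary. The result is given in Lagrangian components. -/
def normalOp (x : Vec n → Vec n) (p : Vec n → ℝ) (W : Vec n → Vec n) : Vec n → Vec n :=
  toLagrange x (proj x (toField x fun y => - grad x (along W p) y))

end EulerLagrangian

end

open EulerLagrangian

namespace EulerLagrangian

variable {n : ℕ}

/-! ### Calculus of partial derivatives up to the boundary -/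

/-! The estimate is an integral identity on the ball whose boundary term has a sign. For a field
`V`, the difference of `∂_a V^d ∂_d V^a` and `(∂_a V^a)²` is a divergence, so its integral is a
boundary integral. Let `f` be any function equal to `y · V` on the sphere. The derivatives of `V` in
that boundary integral can then be traded for the interior integral of `∂f` against first
derivatives of `V`. What remains on the boundary is `-(n - 1)(y · V)² - (|V|² - (y · V)²)`, which is
nonpositive because the ball is convex. This is `integral_energy_le`; the divergence theorem is
needed only as an inequality, `integral_div_nonpos`.

The trace of `(∂V)²` controls `|∂V|²` up to the part of `∂V` that is antisymmetric with respect to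
`g`, hence up to curl, divergence and zero order terms (`msq_le_trace_sq_add`). The term with `∂f`
is absorbed by Young's inequality. For `V = φ W` this gives `integral_multiplier_le`.

Since `p = 0` on the sphere, `∂_c p = y_c (y · ∂p)` there, so `(∂_c p) W^c = y · V` on the sphere as
soon as `φ = y · ∂p` there. Inside, `φ` is taken constant along rays near the boundary and cut off
at the centre, so that only `y · ∂p` on the sphere and its derivatives along rotations enter.
Rotations commute with `y · ∂`, and the rotated `p` still vanishes on the sphere, so these
quantities are bounded through `K₂` and `K₃`. A second multiplier, vanishing on the sphere, covers
the interior with `f = 0`. Together they give `exists_integral_partials_le`, in which `f` is any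
smooth function with the boundary values of `(∂_c p) W^c`.

The optimal `f` is `(∂_c p) W^c - q`, whose gradient is `-AW` in the metric. No regularity of `q` is
needed: the definition of `A` as a projection makes `q` a limit, in the energy norm, of test
functions, so smooth `f` come arbitrarily close (`exists_test_integral_le`), and the error tends to
zero at the end. -/

lemma uniqueDiffOn_omBar : UniqueDiffOn ℝ (OmBar n) :=
  uniqueDiffOn_convex (convex_closedBall _ _)
    ⟨0, by rw [mem_interior_iff_mem_nhds]; exact closedBall_mem_nhds _ one_pos⟩

lemma om_subset_omBar : Om n ⊆ OmBar n := ball_subset_closedBall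

lemma bdry_subset_omBar : bdry n ⊆ OmBar n := sphere_subset_closedBall

lemma SmoothUpTo.differentiableWithinAt {f : Vec n → ℝ} (hf : SmoothUpTo f) {y : Vec n}
    (hy : y ∈ OmBar n) : DifferentiableWithinAt ℝ f (OmBar n) y :=
  (ContDiffOn.differentiableOn hf (by simp)) y hy

lemma SmoothUpTo.continuousOn {F : Type*} [NormedAddCommGroup F] [NormedSpace ℝ F]
    {f : Vec n → F} (hf : SmoothUpTo f) : ContinuousOn f (OmBar n) :=
  ContDiffOn.continuousOn hf

lemma SmoothUpTo.pd {f : Vec n → ℝ} (hf : SmoothUpTo f) (a : Fin n) :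
    SmoothUpTo (EulerLagrangian.pd f a) := by
  have h : ContDiffOn ℝ ∞ (fun y => fderivWithin ℝ f (OmBar n) y) (OmBar n) :=
    ContDiffOn.fderivWithin hf uniqueDiffOn_omBar (by simp)
  exact ContDiffOn.clm_apply h contDiffOn_const

lemma SmoothUpTo.add {f g : Vec n → ℝ} (hf : SmoothUpTo f) (hg : SmoothUpTo g) :
    SmoothUpTo (fun y => f y + g y) := ContDiffOn.add hf hg

lemma SmoothUpTo.sub {f g : Vec n → ℝ} (hf : SmoothUpTo f) (hg : SmoothUpTo g) :
    SmoothUpTo (fun y => f y - g y) := ContDiffOn.sub hf hg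

lemma SmoothUpTo.mul {f g : Vec n → ℝ} (hf : SmoothUpTo f) (hg : SmoothUpTo g) :
    SmoothUpTo (fun y => f y * g y) := ContDiffOn.mul hf hg

lemma SmoothUpTo.sum {ι : Type*} {s : Finset ι} {f : ι → Vec n → ℝ}
    (hf : ∀ i, SmoothUpTo (f i)) : SmoothUpTo (fun y => ∑ i ∈ s, f i y) :=
  ContDiffOn.sum fun i _ => hf i

lemma SmoothUpTo.prod {ι : Type*} {s : Finset ι} {f : ι → Vec n → ℝ}
    (hf : ∀ i, SmoothUpTo (f i)) : SmoothUpTo (fun y => ∏ i ∈ s, f i y) :=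
  contDiffOn_prod fun i _ => hf i

lemma smoothUpTo_const (c : ℝ) : SmoothUpTo (fun _ : Vec n => c) := contDiffOn_const

lemma smoothUpTo_of_contDiff {f : Vec n → ℝ} (hf : ContDiff ℝ ∞ f) : SmoothUpTo f :=
  hf.contDiffOn

lemma contDiff_coord (a : Fin n) : ContDiff ℝ ∞ (fun y : Vec n => y a) :=
  (EuclideanSpace.proj (𝕜 := ℝ) a).contDiff

lemma smoothUpTo_coord (a : Fin n) : SmoothUpTo (fun y : Vec n => y a) :=
  (contDiff_coord a).contDiffOn

lemma SmoothUpTo.comp_coord {V : Vec n → Vec n} (hV : SmoothUpTo V) (a : Fin n) :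
    SmoothUpTo (fun y => V y a) :=
  ((EuclideanSpace.proj (𝕜 := ℝ) a).contDiff.comp_contDiffOn hV :)

lemma pd_congr {f g : Vec n → ℝ} (h : ∀ y ∈ OmBar n, f y = g y) (a : Fin n) {y : Vec n}
    (hy : y ∈ OmBar n) : pd f a y = pd g a y := by
  unfold pd; rw [fderivWithin_congr h (h y hy)]

lemma pd_add {f g : Vec n → ℝ} (hf : SmoothUpTo f) (hg : SmoothUpTo g) (a : Fin n) {y : Vec n}
    (hy : y ∈ OmBar n) : pd (fun y => f y + g y) a y = pd f a y + pd g a y := by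
  unfold pd
  rw [fderivWithin_fun_add (uniqueDiffOn_omBar y hy) (hf.differentiableWithinAt hy)
    (hg.differentiableWithinAt hy)]; rfl

lemma pd_sub {f g : Vec n → ℝ} (hf : SmoothUpTo f) (hg : SmoothUpTo g) (a : Fin n) {y : Vec n}
    (hy : y ∈ OmBar n) : pd (fun y => f y - g y) a y = pd f a y - pd g a y := by
  unfold pd
  rw [fderivWithin_fun_sub (uniqueDiffOn_omBar y hy) (hf.differentiableWithinAt hy)
    (hg.differentiableWithinAt hy)]; rfl

lemma pd_mul {f g : Vec n → ℝ} (hf : SmoothUpTo f) (hg : SmoothUpTo g) (a : Fin n) {y : Vec n}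
    (hy : y ∈ OmBar n) :
    pd (fun y => f y * g y) a y = pd f a y * g y + f y * pd g a y := by
  unfold pd
  rw [fderivWithin_fun_mul (uniqueDiffOn_omBar y hy) (hf.differentiableWithinAt hy)
    (hg.differentiableWithinAt hy)]
  simp; ring

lemma pd_sum {ι : Type*} {s : Finset ι} {f : ι → Vec n → ℝ} (hf : ∀ i, SmoothUpTo (f i))
    (a : Fin n) {y : Vec n} (hy : y ∈ OmBar n) :
    pd (fun y => ∑ i ∈ s, f i y) a y = ∑ i ∈ s, pd (f i) a y := by
  unfold pd
  rw [fderivWithin_fun_sum (uniqueDiffOn_omBar y hy)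
    (fun i _ => (hf i).differentiableWithinAt hy)]
  simp

@[simp] lemma pd_const (c : ℝ) (a : Fin n) (y : Vec n) : pd (fun _ => c) a y = 0 := by
  unfold pd; simp

lemma pd_eq_fderiv {f : Vec n → ℝ} (a : Fin n) {y : Vec n} (hy : y ∈ OmBar n)
    (hf : DifferentiableAt ℝ f y) :
    pd f a y = fderiv ℝ f y (EuclideanSpace.single a 1) := by
  unfold pd; rw [hf.fderivWithin (uniqueDiffOn_omBar y hy)]

lemma pd_eq_fderiv_of_mem_om (f : Vec n → ℝ) (a : Fin n) {y : Vec n} (hy : y ∈ Om n) :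
    pd f a y = fderiv ℝ f y (EuclideanSpace.single a 1) := by
  unfold pd
  rw [fderivWithin_of_mem_nhds (Filter.mem_of_superset (isOpen_ball.mem_nhds hy)
    om_subset_omBar)]

lemma pd_coord (a b : Fin n) {y : Vec n} (hy : y ∈ OmBar n) :
    pd (fun y => y b) a y = if a = b then 1 else 0 := by
  have h : HasFDerivAt (fun y : Vec n => y b) (EuclideanSpace.proj (𝕜 := ℝ) b) y :=
    (EuclideanSpace.proj (𝕜 := ℝ) b).hasFDerivAt
  rw [pd_eq_fderiv a hy h.differentiableAt, h.fderiv]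
  simp [eq_comm]

/-- Symmetry of second derivatives persists at boundary points because every point of the closed
ball lies in the closure of the interior. -/
lemma pd_comm {f : Vec n → ℝ} (hf : SmoothUpTo f) (a b : Fin n) {y : Vec n}
    (hy : y ∈ OmBar n) : pd (pd f a) b y = pd (pd f b) a y := by
  have hcl : y ∈ closure (interior (OmBar n)) := by
    rw [interior_closedBall _ one_ne_zero, closure_ball _ one_ne_zero]; exact hy
  have hs := (hf y hy).isSymmSndFDerivWithinAt
    (by simpa using (WithTop.coe_le_coe.2 le_top : ((2 : ℕ∞) : ℕ∞ω) ≤ ∞)) uniqueDiffOn_omBar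
    hcl hy
  have h : ContDiffOn ℝ ∞ (fun y => fderivWithin ℝ f (OmBar n) y) (OmBar n) :=
    ContDiffOn.fderivWithin hf uniqueDiffOn_omBar (by simp)
  have hd : DifferentiableWithinAt ℝ (fun y => fderivWithin ℝ f (OmBar n) y) (OmBar n) y :=
    (h.differentiableOn (by simp)) y hy
  have key : ∀ c d : Fin n, pd (pd f c) d y =
      fderivWithin ℝ (fderivWithin ℝ f (OmBar n)) (OmBar n) y (EuclideanSpace.single d 1)
        (EuclideanSpace.single c 1) := by
    intro c d
    unfold pd
    rw [fderivWithin_clm_apply (uniqueDiffOn_omBar y hy) hd (by fun_prop)]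
    simp
  rw [key, key]
  exact hs _ _

lemma exists_abs_le_of_continuousOn {f : Vec n → ℝ} (hf : ContinuousOn f (OmBar n)) :
    ∃ C : ℝ, 0 ≤ C ∧ ∀ y ∈ OmBar n, |f y| ≤ C := by
  obtain ⟨C, hC⟩ := (isCompact_closedBall (0 : Vec n) 1).exists_bound_of_continuousOn hf
  exact ⟨max C 0, le_max_right _ _, fun y hy => (hC y hy).trans (le_max_left _ _)⟩

lemma integrableOn_of_continuousOn {f : Vec n → ℝ} (hf : ContinuousOn f (OmBar n)) :
    IntegrableOn f (Om n) :=
  (hf.integrableOn_compact (isCompact_closedBall _ _)).mono_set om_subset_omBar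

lemma SmoothUpTo.integrableOn {f : Vec n → ℝ} (hf : SmoothUpTo f) : IntegrableOn f (Om n) :=
  integrableOn_of_continuousOn hf.continuousOn

/-! ### The sign of the integral of a divergence -/

/-- A Lipschitz bound along the ray through `y` gives `G y ≤ C (1 - ‖y‖)`, and `‖y‖² ≤ ‖y‖` on the
ball. The centre, which lies on no single ray, is covered by `G 0 = 0`. -/
lemma le_const_mul_of_nonpos_on_bdry {G : Vec n → ℝ} (hG : SmoothUpTo G) (h0 : G 0 = 0)
    (hb : ∀ y ∈ bdry n, G y ≤ 0) :
    ∃ C : ℝ, 0 ≤ C ∧ ∀ y ∈ OmBar n, G y ≤ C * (1 - ‖y‖ ^ 2) := by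
  have h : ContDiffOn ℝ ∞ (fun y => fderivWithin ℝ G (OmBar n) y) (OmBar n) :=
    ContDiffOn.fderivWithin hG uniqueDiffOn_omBar (by simp)
  obtain ⟨C, hC⟩ := (isCompact_closedBall (0 : Vec n) 1).exists_bound_of_continuousOn
    h.continuousOn
  have hC0 : 0 ≤ C := (norm_nonneg _).trans (hC 0 (mem_closedBall_self zero_le_one))
  refine ⟨C, hC0, fun y hy => ?_⟩
  have hy1 : ‖y‖ ≤ 1 := by simpa using hy
  by_cases hy0 : y = 0
  · subst hy0; rw [h0]; simpa using hC0
  have hny : 0 < ‖y‖ := norm_pos_iff.2 hy0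
  have hz : ‖‖y‖⁻¹ • y‖ = 1 := by
    rw [norm_smul, norm_inv, norm_norm, inv_mul_cancel₀ hny.ne']
  have hzb : ‖y‖⁻¹ • y ∈ bdry n := by simpa using hz
  have hL := (convex_closedBall (0 : Vec n) 1).norm_image_sub_le_of_norm_fderivWithin_le
    (fun z hz => hG.differentiableWithinAt hz) hC (bdry_subset_omBar hzb) hy
  have hd : ‖y - ‖y‖⁻¹ • y‖ = 1 - ‖y‖ := by
    have : y - ‖y‖⁻¹ • y = (1 - ‖y‖⁻¹) • y := by rw [sub_smul, one_smul]
    rw [this, norm_smul, Real.norm_eq_abs, abs_of_nonpos, neg_sub, sub_mul,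
      inv_mul_cancel₀ hny.ne', one_mul]
    have := one_le_inv₀ hny |>.2 hy1
    linarith
  rw [hd] at hL
  have h1 := hb _ hzb
  have h2 := (le_abs_self _).trans hL
  nlinarith [mul_nonneg hC0 (mul_nonneg hny.le (sub_nonneg.2 hy1))]

/-! ### Cutoff functions and integration by parts on the ball. -/

lemma deriv_smoothTransition_eq_zero {t : ℝ} (h : t < 0 ∨ 1 < t) :
    deriv Real.smoothTransition t = 0 := by
  rcases h with h | h
  · have : Real.smoothTransition =ᶠ[nhds t] fun _ => 0 := by
      filter_upwards [gt_mem_nhds h] with s hs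
      exact Real.smoothTransition.zero_of_nonpos hs.le
    rw [this.deriv_eq]; simp
  · have : Real.smoothTransition =ᶠ[nhds t] fun _ => 1 := by
      filter_upwards [lt_mem_nhds h] with s hs
      exact Real.smoothTransition.one_of_one_le hs.le
    rw [this.deriv_eq]; simp

lemma contDiff_smoothTransition : ContDiff ℝ ∞ Real.smoothTransition :=
  Real.smoothTransition.contDiff

lemma exists_bound_deriv_smoothTransition :
    ∃ M : ℝ, 0 ≤ M ∧ ∀ t, |deriv Real.smoothTransition t| ≤ M := by
  have hc : Continuous (deriv Real.smoothTransition) :=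
    contDiff_smoothTransition.continuous_deriv (by simp)
  obtain ⟨M, hM⟩ := (isCompact_Icc (a := (0 : ℝ)) (b := 1)).exists_bound_of_continuousOn
    hc.continuousOn
  have h0 : 0 ≤ M := (norm_nonneg _).trans (hM 0 (by simp))
  refine ⟨M, h0, fun t => ?_⟩
  by_cases ht : t < 0 ∨ 1 < t
  · rw [deriv_smoothTransition_eq_zero ht]; simpa
  · push Not at ht; exact hM t ht

lemma deriv_smoothTransition_nonneg (t : ℝ) : 0 ≤ deriv Real.smoothTransition t :=
  Real.smoothTransition.monotone.deriv_nonneg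

/-- A cutoff function that vanishes near the boundary. -/
noncomputable def cutoff (N : ℕ) (y : Vec n) : ℝ := Real.smoothTransition (N * (1 - ‖y‖ ^ 2) - 1)

lemma contDiff_cutoff (N : ℕ) : ContDiff ℝ ∞ (cutoff (n := n) N) := by
  apply contDiff_smoothTransition.comp
  have : ContDiff ℝ ∞ (fun y : Vec n => ‖y‖ ^ 2) := contDiff_norm_sq ℝ
  fun_prop

lemma fderiv_cutoff (N : ℕ) (y : Vec n) (a : Fin n) :
    fderiv ℝ (cutoff N) y (EuclideanSpace.single a 1) =
      - (2 * N * deriv Real.smoothTransition (N * (1 - ‖y‖ ^ 2) - 1)) * y a := by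
  have h1 : HasFDerivAt (fun y : Vec n => (N : ℝ) * (1 - ‖y‖ ^ 2) - 1)
      ((N : ℝ) • (-((2 : ℝ) • innerSL ℝ y))) y := by
    have := (hasStrictFDerivAt_norm_sq y).hasFDerivAt
    have e : (2 : ℝ) • innerSL ℝ y = 2 • innerSL ℝ y := by rw [two_smul, two_nsmul]
    rw [e]
    exact ((this.const_sub 1).const_mul (N : ℝ)).sub_const 1
  have h2 : HasDerivAt Real.smoothTransition (deriv Real.smoothTransition
      (N * (1 - ‖y‖ ^ 2) - 1)) (N * (1 - ‖y‖ ^ 2) - 1) :=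
    (contDiff_smoothTransition.differentiable (by simp) _).hasDerivAt
  have h3 := h2.comp_hasFDerivAt y h1
  have h4 : fderiv ℝ (cutoff N) y = _ := h3.fderiv
  rw [h4]
  simp [EuclideanSpace.inner_single_right]
  ring

lemma tsupport_cutoff_subset {N : ℕ} (hN : 0 < N) : tsupport (cutoff (n := n) N) ⊆ Om n := by
  have hc : IsClosed {y : Vec n | 1 ≤ N * (1 - ‖y‖ ^ 2)} :=
    isClosed_le continuous_const (by fun_prop)
  refine (closure_minimal (fun y hy => ?_) hc).trans fun y hy => ?_
  · by_contra h
    exact hy (Real.smoothTransition.zero_of_nonpos (by simp at h; linarith))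
  · have : (0 : ℝ) < N := by exact_mod_cast hN
    have h1 : 0 < 1 - ‖y‖ ^ 2 := by
      by_contra h
      have := mul_nonpos_of_nonneg_of_nonpos this.le (not_lt.1 h)
      simp at hy; linarith
    have h2 : ‖y‖ < 1 := by
      by_contra h
      nlinarith [not_lt.1 h]
    simpa using h2

/-- The cutoff has compact support in `Ω`, so integration by parts on the whole space leaves no
boundary term. Its derivative points inwards along `y`, which is where the flux density `y · X`
comes from later. -/
lemma integral_cutoff_mul_pd {f : Vec n → ℝ} (hf : SmoothUpTo f) (a : Fin n) {N : ℕ}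
    (hN : 0 < N) :
    ∫ y in Om n, cutoff N y * pd f a y =
      ∫ y in Om n, 2 * N * deriv Real.smoothTransition (N * (1 - ‖y‖ ^ 2) - 1) *
        (y a * f y) := by
  have hcont : Continuous (fun y : Vec n => fderiv ℝ (cutoff N) y
      (EuclideanSpace.single a 1)) :=
    ((contDiff_cutoff N).continuous_fderiv (by simp)).clm_apply continuous_const
  have hsup : ∀ y ∉ Om n, cutoff N y = 0 := fun y hy =>
    image_eq_zero_of_notMem_tsupport fun h => hy (tsupport_cutoff_subset hN h)
  have hsup' : ∀ y ∉ Om n, fderiv ℝ (cutoff N) y (EuclideanSpace.single a 1) = 0 := by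
    intro y hy
    have : fderiv ℝ (cutoff N) y = 0 := by
      apply image_eq_zero_of_notMem_tsupport
      exact fun h => hy (tsupport_cutoff_subset hN (tsupport_fderiv_subset ℝ h))
    rw [this]; rfl
  have key : ∀ u v : Vec n → ℝ, ContinuousOn u (OmBar n) → ContinuousOn v (OmBar n) →
      (∀ y ∉ Om n, u y = 0) → Integrable (fun y => u y * v y) := by
    intro u v hu hv h0
    rw [← integrableOn_iff_integrable_of_support_subset (s := Om n)]
    · exact integrableOn_of_continuousOn (hu.mul hv)
    · intro y hy; by_contra h; exact hy (by simp [h0 y h])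
  have e1 : ∫ y in Om n, cutoff N y * pd f a y =
      ∫ y, cutoff N y * fderiv ℝ f y (EuclideanSpace.single a 1) := by
    rw [← setIntegral_eq_integral_of_forall_compl_eq_zero (s := Om n) (μ := volume)
      (f := fun y => cutoff N y * fderiv ℝ f y (EuclideanSpace.single a 1))
      (fun y hy => by rw [hsup y hy, zero_mul])]
    apply setIntegral_congr_fun measurableSet_ball
    intro y hy
    simp only [pd_eq_fderiv_of_mem_om f a hy]
  have i1 : Integrable (fun y => cutoff N y * fderiv ℝ f y (EuclideanSpace.single a 1)) := by
    refine (key (cutoff N) (pd f a) (contDiff_cutoff N).continuous.continuousOn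
      (hf.pd a).continuousOn hsup).congr (Filter.Eventually.of_forall fun y => ?_)
    by_cases hy : y ∈ Om n
    · simp only [pd_eq_fderiv_of_mem_om f a hy]
    · simp [hsup y hy]
  rw [e1, integral_mul_fderiv_eq_neg_fderiv_mul_of_integrable
    (key _ _ hcont.continuousOn hf.continuousOn hsup') i1
    (key _ _ (contDiff_cutoff N).continuous.continuousOn hf.continuousOn hsup)
    (fun y _ => (contDiff_cutoff N).differentiable (by simp) y),
    ← setIntegral_eq_integral_of_forall_compl_eq_zero (s := Om n)
      (fun y hy => by rw [hsup' y hy, zero_mul]), ← integral_neg]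
  · congr 1; ext y; rw [fderiv_cutoff]; ring
  · intro y hy
    exact (hf.contDiffAt (Filter.mem_of_superset
      (isOpen_ball.mem_nhds (tsupport_cutoff_subset hN hy)) om_subset_omBar)).differentiableAt
      (by simp)

lemma eventually_one_lt_cutoff_arg {y : Vec n} (hy : y ∈ Om n) :
    ∀ᶠ N : ℕ in Filter.atTop, 1 < (N : ℝ) * (1 - ‖y‖ ^ 2) - 1 := by
  have hy1 : ‖y‖ < 1 := by simpa using hy
  have hpos : 0 < 1 - ‖y‖ ^ 2 := by nlinarith [norm_nonneg y]
  have : Filter.Tendsto (fun N : ℕ => (N : ℝ) * (1 - ‖y‖ ^ 2)) Filter.atTop Filter.atTop :=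
    tendsto_natCast_atTop_atTop.atTop_mul_const hpos
  filter_upwards [this.eventually_gt_atTop 2] with N hN
  linarith

/-- If `y · X ≤ 0` on the boundary then the integral of `∂_a X^a` is nonpositive. -/
theorem integral_div_nonpos {X : Fin n → Vec n → ℝ} (hX : ∀ a, SmoothUpTo (X a))
    (hb : ∀ y ∈ bdry n, ∑ a, y a * X a y ≤ 0) :
    ∫ y in Om n, ∑ a, pd (X a) a y ≤ 0 := by
  have hG : SmoothUpTo (fun y => ∑ a, y a * X a y) :=
    SmoothUpTo.sum fun a => (smoothUpTo_coord a).mul (hX a)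
  obtain ⟨C, hC0, hC⟩ := le_const_mul_of_nonpos_on_bdry hG (by simp) hb
  obtain ⟨M, hM0, hM⟩ := exists_bound_deriv_smoothTransition
  have hdiv : SmoothUpTo (fun y => ∑ a, pd (X a) a y) := SmoothUpTo.sum fun a => (hX a).pd a
  have hcc : ∀ N : ℕ, Continuous (cutoff (n := n) N) := fun N => (contDiff_cutoff N).continuous
  have hdc : ∀ N : ℕ, Continuous fun y : Vec n =>
      2 * (N : ℝ) * deriv Real.smoothTransition (N * (1 - ‖y‖ ^ 2) - 1) := by
    intro N
    have : Continuous (deriv Real.smoothTransition) :=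
      contDiff_smoothTransition.continuous_deriv (by simp)
    fun_prop
  -- The integral with the cutoff tends to the full integral. Integrated by parts, it is at most the
  -- integral treated next, which tends to zero.
  have lim1 : Filter.Tendsto (fun N : ℕ => ∫ y in Om n, cutoff N y * ∑ a, pd (X a) a y)
      Filter.atTop (nhds (∫ y in Om n, ∑ a, pd (X a) a y)) := by
    refine tendsto_integral_of_dominated_convergence (fun y => |∑ a, pd (X a) a y|)
      (fun N => (integrableOn_of_continuousOn
        ((hcc N).continuousOn.mul hdiv.continuousOn)).aestronglyMeasurable)
      hdiv.integrableOn.norm (fun N => Filter.Eventually.of_forall fun y => ?_) ?_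
    · rw [Real.norm_eq_abs, abs_mul, abs_of_nonneg (show 0 ≤ cutoff N y from Real.smoothTransition.nonneg _)]
      exact mul_le_of_le_one_left (abs_nonneg _) (Real.smoothTransition.le_one _)
    · filter_upwards [ae_restrict_mem measurableSet_ball] with y hy
      apply tendsto_const_nhds.congr'
      filter_upwards [eventually_one_lt_cutoff_arg hy] with N hN
      rw [cutoff, Real.smoothTransition.one_of_one_le hN.le, one_mul]
  -- Where the derivative of the transition is not zero, `N (1 - ‖y‖²) ≤ 2`. This compensates the
  -- factor `N` and gives the dominating constant `4 M C`; at a fixed interior point the integrand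
  -- is eventually zero.
  have lim2 : Filter.Tendsto (fun N : ℕ => ∫ y in Om n,
      2 * (N : ℝ) * deriv Real.smoothTransition (N * (1 - ‖y‖ ^ 2) - 1) *
        (C * (1 - ‖y‖ ^ 2))) Filter.atTop (nhds 0) := by
    rw [← integral_zero (Vec n) ℝ (μ := volume.restrict (Om n))]
    refine tendsto_integral_of_dominated_convergence (fun _ => 4 * M * C)
      (fun N => (integrableOn_of_continuousOn (Continuous.continuousOn
        ((hdc N).mul (by fun_prop)))).aestronglyMeasurable)
      (integrableOn_of_continuousOn continuousOn_const) (fun N => ?_) ?_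
    · filter_upwards [ae_restrict_mem measurableSet_ball] with y hy
      have hy1 : ‖y‖ < 1 := by simpa using hy
      have hpos : 0 < 1 - ‖y‖ ^ 2 := by nlinarith [norm_nonneg y]
      by_cases h : 1 < (N : ℝ) * (1 - ‖y‖ ^ 2) - 1
      · rw [deriv_smoothTransition_eq_zero (Or.inr h)]; simp; positivity
      · rw [Real.norm_eq_abs, abs_mul, abs_mul, abs_of_nonneg (by positivity : (0 : ℝ) ≤ 2 * N),
          abs_of_nonneg (by positivity : 0 ≤ C * (1 - ‖y‖ ^ 2))]
        calc 2 * (N : ℝ) * |deriv Real.smoothTransition (N * (1 - ‖y‖ ^ 2) - 1)| *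
              (C * (1 - ‖y‖ ^ 2))
            = 2 * |deriv Real.smoothTransition (N * (1 - ‖y‖ ^ 2) - 1)| * C *
              (N * (1 - ‖y‖ ^ 2)) := by ring
          _ ≤ 2 * M * C * 2 := by
              have := hM (N * (1 - ‖y‖ ^ 2) - 1)
              gcongr
              linarith
          _ = 4 * M * C := by ring
    · filter_upwards [ae_restrict_mem measurableSet_ball] with y hy
      apply tendsto_const_nhds.congr'
      filter_upwards [eventually_one_lt_cutoff_arg hy] with N hN
      rw [deriv_smoothTransition_eq_zero (Or.inr hN)]; simp
  refine le_of_tendsto_of_tendsto lim1 lim2 ?_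
  filter_upwards [Filter.eventually_gt_atTop 0] with N hN
  have e : ∫ y in Om n, cutoff N y * ∑ a, pd (X a) a y =
      ∫ y in Om n, 2 * (N : ℝ) * deriv Real.smoothTransition (N * (1 - ‖y‖ ^ 2) - 1) *
        ∑ a, y a * X a y := by
    simp only [Finset.mul_sum]
    rw [integral_finsetSum, integral_finsetSum]
    · exact Finset.sum_congr rfl fun a _ => integral_cutoff_mul_pd (hX a) a hN
    · exact fun a _ => integrableOn_of_continuousOn ((hdc N).continuousOn.mul
        ((smoothUpTo_coord a).mul (hX a)).continuousOn)
    · exact fun a _ => integrableOn_of_continuousOn ((hcc N).continuousOn.mul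
        ((hX a).pd a).continuousOn)
  rw [e]
  refine setIntegral_mono_on (integrableOn_of_continuousOn ((hdc N).continuousOn.mul
    hG.continuousOn)) (integrableOn_of_continuousOn (Continuous.continuousOn
        ((hdc N).mul (by fun_prop)))) measurableSet_ball fun y hy => ?_
  have := deriv_smoothTransition_nonneg (N * (1 - ‖y‖ ^ 2) - 1)
  exact mul_le_mul_of_nonneg_left (hC y (om_subset_omBar hy)) (by positivity)

/-! ### Radial projection to the boundary -/

/-- The radial derivative `y^a ∂_a f`. -/
noncomputable def rad (f : Vec n → ℝ) (y : Vec n) : ℝ := ∑ a, y a * pd f a y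

lemma SmoothUpTo.rad {f : Vec n → ℝ} (hf : SmoothUpTo f) : SmoothUpTo (rad f) :=
  SmoothUpTo.sum fun a => (smoothUpTo_coord a).mul (hf.pd a)

lemma sum_sq_eq_one {y : Vec n} (hy : y ∈ bdry n) : ∑ a, y a * y a = 1 := by
  have h : ‖y‖ = 1 := by simpa using hy
  have := EuclideanSpace.real_norm_sq_eq y
  rw [h] at this
  simpa [sq] using this.symm

lemma fderivWithin_eq_sum (f : Vec n → ℝ) (y v : Vec n) :
    fderivWithin ℝ f (OmBar n) y v = ∑ a, v a * pd f a y := by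
  have h : v = ∑ a, v a • (EuclideanSpace.single a (1 : ℝ)) := by
    ext b; simp [Pi.single_apply]
  conv_lhs => rw [h]
  simp [pd]

/-- The radial projection to the boundary. -/
noncomputable def unitVec (y : Vec n) : Vec n := ‖y‖⁻¹ • y

lemma unitVec_mem_bdry {y : Vec n} (hy : y ≠ 0) : unitVec y ∈ bdry n := by
  have : ‖unitVec y‖ = 1 := by
    rw [unitVec, norm_smul, norm_inv, norm_norm, inv_mul_cancel₀ (norm_ne_zero_iff.2 hy)]
  simpa using this

lemma unitVec_of_mem_bdry {y : Vec n} (hy : y ∈ bdry n) : unitVec y = y := by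
  have h : ‖y‖ = 1 := by simpa using hy
  rw [unitVec, h, inv_one, one_smul]

lemma contDiffAt_unitVec {y : Vec n} (hy : y ≠ 0) : ContDiffAt ℝ ∞ (unitVec (n := n)) y :=
  ((contDiffAt_norm ℝ hy).inv (norm_ne_zero_iff.2 hy)).smul contDiffAt_id

lemma fderiv_unitVec {y : Vec n} (hy : y ≠ 0) (e : Vec n) :
    fderiv ℝ (unitVec (n := n)) y e =
      ‖y‖⁻¹ • (e - (inner ℝ (unitVec y) e : ℝ) • unitVec y) := by
  have hn : ‖y‖ ≠ 0 := norm_ne_zero_iff.2 hy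
  have hdn : DifferentiableAt ℝ (fun y : Vec n => ‖y‖) y :=
    (contDiffAt_norm (n := 1) ℝ hy).differentiableAt (by simp)
  have hsq : fderiv ℝ (fun y : Vec n => ‖y‖) y e = ‖y‖⁻¹ * inner ℝ y e := by
    have h1 := (hdn.hasFDerivAt.pow 2).unique (hasStrictFDerivAt_norm_sq y).hasFDerivAt
    have h2 := congrArg (fun L : Vec n →L[ℝ] ℝ => L e) h1
    simp at h2
    field_simp
    linarith
  have hinv : HasFDerivAt (fun y : Vec n => ‖y‖⁻¹) _ y :=
    (hasDerivAt_inv hn).comp_hasFDerivAt y hdn.hasFDerivAt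
  have h := (hinv.smul (hasFDerivAt_id y)).fderiv
  have h' : fderiv ℝ (unitVec (n := n)) y = _ := h
  rw [h']
  simp only [add_apply, smul_apply,
    ContinuousLinearMap.smulRight_apply, hsq, ContinuousLinearMap.id_apply, unitVec, id,
    inner_smul_left, smul_sub, smul_smul, smul_eq_mul]
  rw [sub_eq_add_neg, ← neg_smul]
  congr 2
  simp
  field_simp

/-- Although `f` is smooth only on the closed ball, the composition is smooth in a full
neighbourhood, since the projection takes values in the sphere. -/
lemma SmoothUpTo.comp_unitVec {f : Vec n → ℝ} (hf : SmoothUpTo f) {y : Vec n} (hy : y ≠ 0) :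
    ContDiffAt ℝ ∞ (fun z => f (unitVec z)) y := by
  have h := (hf _ (bdry_subset_omBar (unitVec_mem_bdry hy))).comp (t := OmBar n)
    (s := {z | z ≠ 0}) y (contDiffAt_unitVec hy).contDiffWithinAt
    (fun z hz => bdry_subset_omBar (unitVec_mem_bdry hz))
  exact h.contDiffAt (isOpen_ne.mem_nhds hy)

/-- The derivative of the radial projection kills the radial direction, so only the tangential part
of `∂f` on the sphere survives. -/
lemma pd_comp_unitVec {f : Vec n → ℝ} (hf : SmoothUpTo f) {y : Vec n} (hy : y ≠ 0)
    (hy1 : y ∈ OmBar n) (a : Fin n) :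
    pd (fun z => f (unitVec z)) a y =
      ‖y‖⁻¹ * (pd f a (unitVec y) - unitVec y a * rad f (unitVec y)) := by
  have hd := (hf.comp_unitVec hy).differentiableAt (by simp)
  rw [pd_eq_fderiv a hy1 hd]
  have h1 := (hf.differentiableWithinAt (bdry_subset_omBar
    (unitVec_mem_bdry hy))).hasFDerivWithinAt.comp_hasFDerivAt y
    ((contDiffAt_unitVec hy).differentiableAt (by simp)).hasFDerivAt
    (by filter_upwards [isOpen_ne.mem_nhds hy] with z hz using
      bdry_subset_omBar (unitVec_mem_bdry hz))
  have h2 : fderiv ℝ (fun z => f (unitVec z)) y = _ := h1.fderiv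
  rw [h2, ContinuousLinearMap.comp_apply, fderiv_unitVec hy, map_smul, map_sub, map_smul,
    fderivWithin_eq_sum f _ (unitVec y), EuclideanSpace.inner_single_right]
  simp [pd, rad]

/-- On the boundary, the gradient of a function that vanishes there is radial. -/
lemma pd_eq_of_eq_zero_on_bdry {f : Vec n → ℝ} (hf : SmoothUpTo f)
    (h0 : ∀ y ∈ bdry n, f y = 0) {y : Vec n} (hy : y ∈ bdry n) (a : Fin n) :
    pd f a y = y a * rad f y := by
  have hy0 : y ≠ 0 := by rintro rfl; simp at hy
  have h := pd_comp_unitVec hf hy0 (bdry_subset_omBar hy) a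
  rw [unitVec_of_mem_bdry hy, (by simpa using hy : ‖y‖ = 1), inv_one, one_mul] at h
  -- The composition vanishes identically near `y`, so the tangential part of `∂f` is zero.
  have h2 : fderiv ℝ (fun z => f (unitVec z)) y = 0 := by
    have : (fun z => f (unitVec z)) =ᶠ[nhds y] fun _ => 0 := by
      filter_upwards [isOpen_ne.mem_nhds hy0] with z hz using h0 _ (unitVec_mem_bdry hz)
    rw [this.fderiv_eq]; simp
  rw [pd_eq_fderiv a (bdry_subset_omBar hy)
    ((hf.comp_unitVec hy0).differentiableAt (by simp)), h2] at h
  simp at h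
  linarith

/-! ### The energy inequality -/

/-- The divergence `∂_a V^a` in the flat metric. -/
noncomputable def flatDiv (V : Fin n → Vec n → ℝ) (y : Vec n) : ℝ := ∑ d, pd (V d) d y

/-- The divergence free field `(n - 1) V^a + y^b ∂_b V^a - y^a ∂_b V^b`. -/
noncomputable def rotField (V : Fin n → Vec n → ℝ) (a : Fin n) (y : Vec n) : ℝ :=
  ((n : ℝ) - 1) * V a y + rad (V a) y - y a * flatDiv V y

lemma SmoothUpTo.flatDiv {V : Fin n → Vec n → ℝ} (hV : ∀ a, SmoothUpTo (V a)) :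
    SmoothUpTo (flatDiv V) := SmoothUpTo.sum fun d => (hV d).pd d

lemma SmoothUpTo.rotField {V : Fin n → Vec n → ℝ} (hV : ∀ a, SmoothUpTo (V a)) (a : Fin n) :
    SmoothUpTo (rotField V a) :=
  (((smoothUpTo_const _).mul (hV a)).add (hV a).rad).sub
    ((smoothUpTo_coord a).mul (SmoothUpTo.flatDiv hV))

lemma pd_rad {f : Vec n → ℝ} (hf : SmoothUpTo f) (a : Fin n) {y : Vec n} (hy : y ∈ OmBar n) :
    pd (rad f) a y = pd f a y + ∑ b, y b * pd (pd f b) a y := by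
  have h := pd_sum (s := Finset.univ) (f := fun b y => y b * pd f b y)
    (fun b => (smoothUpTo_coord b).mul (hf.pd b)) a hy
  have h' : pd (rad f) a y = _ := h
  rw [h']
  simp only [fun b => pd_mul (smoothUpTo_coord b) (hf.pd b) a hy, pd_coord a _ hy,
    Finset.sum_add_distrib]
  simp

lemma pd_flatDiv {V : Fin n → Vec n → ℝ} (hV : ∀ a, SmoothUpTo (V a)) (a : Fin n) {y : Vec n}
    (hy : y ∈ OmBar n) : pd (flatDiv V) a y = ∑ d, pd (pd (V d) d) a y :=
  pd_sum (s := Finset.univ) (f := fun d => pd (V d) d) (fun d => (hV d).pd d) a hy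

/-- `rotField V a` is `∂_b (y^b V^a - y^a V^b)`, the divergence of an antisymmetric tensor, so its
own divergence is zero. Its flux through the sphere is minus the surface divergence of the
tangential part of `V`. -/
lemma sum_pd_rotField {V : Fin n → Vec n → ℝ} (hV : ∀ a, SmoothUpTo (V a)) {y : Vec n}
    (hy : y ∈ OmBar n) : ∑ a, pd (rotField V a) a y = 0 := by
  have h : ∀ a, pd (rotField V a) a y = ((n : ℝ) - 1) * pd (V a) a y +
      (pd (V a) a y + ∑ b, y b * pd (pd (V a) b) a y) -
      (flatDiv V y + ∑ d, y a * pd (pd (V d) d) a y) := by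
    intro a
    have e1 := pd_sub (((smoothUpTo_const ((n : ℝ) - 1)).mul (hV a)).add (hV a).rad)
      ((smoothUpTo_coord a).mul (SmoothUpTo.flatDiv hV)) a hy
    have e2 : pd (rotField V a) a y = _ := e1
    rw [e2, pd_add ((smoothUpTo_const ((n : ℝ) - 1)).mul (hV a)) (hV a).rad a hy,
      pd_mul (smoothUpTo_const _) (hV a) a hy, pd_rad (hV a) a hy,
      pd_mul (smoothUpTo_coord a) (SmoothUpTo.flatDiv hV) a hy, pd_flatDiv hV a hy,
      pd_coord a a hy, Finset.mul_sum]
    simp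
  simp only [h, Finset.sum_sub_distrib, Finset.sum_add_distrib, ← Finset.mul_sum]
  have e3 : ∑ a, ∑ b, y b * pd (pd (V a) b) a y = ∑ a, y a * ∑ d, pd (pd (V d) d) a y := by
    rw [Finset.sum_comm]
    refine Finset.sum_congr rfl fun a _ => ?_
    rw [Finset.mul_sum]
    exact Finset.sum_congr rfl fun d _ => by rw [pd_comm (hV d) a d hy]
  rw [e3]
  simp [flatDiv]
  ring

/-- A field with flux `(V - (y · V) y) · ∂f` through the boundary. -/
noncomputable def tangentField (V : Fin n → Vec n → ℝ) (f : Vec n → ℝ) (a : Fin n) (y : Vec n) : ℝ :=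
  y a * (∑ c, V c y * pd f c y) - V a y * rad f y

lemma SmoothUpTo.tangentField {V : Fin n → Vec n → ℝ} (hV : ∀ a, SmoothUpTo (V a))
    {f : Vec n → ℝ} (hf : SmoothUpTo f) (a : Fin n) : SmoothUpTo (tangentField V f a) :=
  ((smoothUpTo_coord a).mul (SmoothUpTo.sum fun c => (hV c).mul (hf.pd c))).sub
    ((hV a).mul hf.rad)

/-- `tangentField V f a` is `(y^a V^c - y^c V^a) ∂_c f`. Second derivatives of `f` cancel by
antisymmetry, and the divergence of the tensor is `rotField`. -/
lemma sum_pd_tangentField {V : Fin n → Vec n → ℝ} (hV : ∀ a, SmoothUpTo (V a))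
    {f : Vec n → ℝ} (hf : SmoothUpTo f) {y : Vec n} (hy : y ∈ OmBar n) :
    ∑ a, pd (tangentField V f a) a y = ∑ a, pd f a y * rotField V a y := by
  have hs : SmoothUpTo (fun y => ∑ c, V c y * pd f c y) :=
    SmoothUpTo.sum fun c => (hV c).mul (hf.pd c)
  have h : ∀ a, pd (tangentField V f a) a y =
      ((∑ c, V c y * pd f c y) +
        ((∑ c, y a * (pd (V c) a y * pd f c y)) + ∑ c, y a * (V c y * pd (pd f c) a y))) -
      (pd (V a) a y * rad f y + (V a y * pd f a y + ∑ b, V a y * (y b * pd (pd f b) a y))) := by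
    intro a
    have e1 := pd_sub ((smoothUpTo_coord a).mul hs) ((hV a).mul hf.rad) a hy
    have e2 : pd (tangentField V f a) a y = _ := e1
    rw [e2, pd_mul (smoothUpTo_coord a) hs a hy, pd_mul (hV a) hf.rad a hy, pd_rad hf a hy,
      pd_sum (fun c => (hV c).mul (hf.pd c)) a hy, pd_coord a a hy]
    simp only [fun c => pd_mul (hV c) (hf.pd c) a hy, Finset.sum_add_distrib, mul_add,
      Finset.mul_sum]
    simp
  simp only [h, Finset.sum_sub_distrib, Finset.sum_add_distrib]
  have e3 : ∑ a, ∑ c, y a * (V c y * pd (pd f c) a y) =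
      ∑ a, ∑ b, V a y * (y b * pd (pd f b) a y) := by
    rw [Finset.sum_comm]
    exact Finset.sum_congr rfl fun a _ => Finset.sum_congr rfl fun b _ => by
      rw [pd_comm hf a b hy]; ring
  have e4 : ∑ a, pd f a y * rotField V a y = ((n : ℝ) - 1) * (∑ a, V a y * pd f a y) +
      (∑ a, ∑ c, y a * (pd (V c) a y * pd f c y)) - flatDiv V y * rad f y := by
    rw [Finset.sum_comm]
    simp only [rad, rotField, Finset.mul_sum, ← Finset.sum_add_distrib, ← Finset.sum_sub_distrib,
      mul_add, mul_sub]
    refine Finset.sum_congr rfl fun a _ => ?_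
    congr 1
    · congr 1
      · ring
      · exact Finset.sum_congr rfl fun b _ => by ring
    · ring
  rw [e3, e4, flatDiv, Finset.sum_mul]
  simp
  ring

/-- The field `V^d ∂_d V^a - V^a ∂_d V^d`. -/
noncomputable def quadField (V : Fin n → Vec n → ℝ) (a : Fin n) (y : Vec n) : ℝ :=
  (∑ d, V d y * pd (V a) d y) - V a y * flatDiv V y

lemma SmoothUpTo.quadField {V : Fin n → Vec n → ℝ} (hV : ∀ a, SmoothUpTo (V a)) (a : Fin n) :
    SmoothUpTo (quadField V a) :=
  (SmoothUpTo.sum fun d => (hV d).mul ((hV a).pd d)).sub ((hV a).mul (SmoothUpTo.flatDiv hV))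

/-- The second derivatives of `V` from the two terms cancel, so the quadratic form in `∂V` is an
exact divergence. -/
lemma sum_pd_quadField {V : Fin n → Vec n → ℝ} (hV : ∀ a, SmoothUpTo (V a)) {y : Vec n}
    (hy : y ∈ OmBar n) :
    ∑ a, pd (quadField V a) a y =
      (∑ a, ∑ d, pd (V d) a y * pd (V a) d y) - flatDiv V y ^ 2 := by
  have h : ∀ a, pd (quadField V a) a y =
      ((∑ d, pd (V d) a y * pd (V a) d y) + ∑ d, V d y * pd (pd (V a) d) a y) -
      (pd (V a) a y * flatDiv V y + ∑ d, V a y * pd (pd (V d) d) a y) := by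
    intro a
    have e1 := pd_sub (SmoothUpTo.sum (s := Finset.univ) fun d => (hV d).mul ((hV a).pd d))
      ((hV a).mul (SmoothUpTo.flatDiv hV)) a hy
    have e2 : pd (quadField V a) a y = _ := e1
    rw [e2, pd_mul (hV a) (SmoothUpTo.flatDiv hV) a hy, pd_flatDiv hV a hy,
      pd_sum (fun d => (hV d).mul ((hV a).pd d)) a hy]
    simp only [fun d => pd_mul (hV d) ((hV a).pd d) a hy, Finset.sum_add_distrib,
      Finset.mul_sum]
  simp only [h, Finset.sum_sub_distrib, Finset.sum_add_distrib]
  have e3 : ∑ a, ∑ d, V d y * pd (pd (V a) d) a y = ∑ a, ∑ d, V a y * pd (pd (V d) d) a y := by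
    rw [Finset.sum_comm]
    exact Finset.sum_congr rfl fun a _ => Finset.sum_congr rfl fun b _ => by
      rw [pd_comm (hV b) a b hy]
  rw [e3, ← Finset.sum_mul]
  simp only [flatDiv]
  ring

/-- All derivatives of `V` cancel in this combination of fluxes. With `ν = y · V` the sum equals
`-(n - 1) ν² - (|V|² - ν²)`, the contribution of the curvature of the sphere. -/
lemma flux_nonpos {V : Fin n → Vec n → ℝ} (hV : ∀ a, SmoothUpTo (V a))
    {f : Vec n → ℝ} (hf : SmoothUpTo f) (hb : ∀ y ∈ bdry n, f y = ∑ a, y a * V a y)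
    {y : Vec n} (hy : y ∈ bdry n) :
    ∑ a, y a * (quadField V a y - f y * rotField V a y - tangentField V f a y) ≤ 0 := by
  have hyb := bdry_subset_omBar hy
  have hg : SmoothUpTo (fun y => ∑ a, y a * V a y) :=
    SmoothUpTo.sum fun a => (smoothUpTo_coord a).mul (hV a)
  have ht := fun a => pd_eq_of_eq_zero_on_bdry (hf.sub hg)
    (fun y hy => by rw [hb y hy, sub_self]) hy a
  have hpg : ∀ a, pd (fun y => ∑ b, y b * V b y) a y = V a y + ∑ b, y b * pd (V b) a y := by
    intro a
    rw [pd_sum (fun b => (smoothUpTo_coord b).mul (hV b)) a hyb]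
    simp only [fun b => pd_mul (smoothUpTo_coord b) (hV b) a hyb, pd_coord a _ hyb,
      Finset.sum_add_distrib]
    simp
  -- `f` and `y · V` agree only on the sphere, so their gradients may differ there by a radial
  -- vector. Its size `r` is unknown, but `tangentField` has a purely tangential flux and `r` drops
  -- out of it.
  set r := rad (fun y => f y - ∑ a, y a * V a y) y with hr
  have hF : ∀ a, pd f a y = V a y + ∑ b, y b * pd (V b) a y + y a * r := by
    intro a
    have := ht a
    rw [pd_sub hf hg a hyb, hpg] at this
    linarith
  have h1 := sum_sq_eq_one hy
  have hν := hb y hy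
  set ν := f y
  set t := flatDiv V y with htd
  have c1 : ∑ a, y a * quadField V a y = (∑ d, V d y * ∑ a, y a * pd (V a) d y) - ν * t := by
    simp only [quadField, mul_sub, Finset.sum_sub_distrib, hν, Finset.sum_mul, Finset.mul_sum]
    rw [Finset.sum_comm]
    congr 1
    · exact Finset.sum_congr rfl fun a _ => Finset.sum_congr rfl fun b _ => by ring
    · exact Finset.sum_congr rfl fun b _ => by ring
  have c2 : ∑ a, y a * rotField V a y =
      ((n : ℝ) - 1) * ν + (∑ a, y a * ∑ b, y b * pd (V b) a y) - t := by
    have : ∑ a, y a * rotField V a y = ((n : ℝ) - 1) * (∑ a, y a * V a y) +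
      (∑ a, y a * rad (V a) y) - (∑ a, y a * y a) * t := by
      simp only [rotField, Finset.mul_sum, Finset.sum_mul, ← Finset.sum_add_distrib,
        ← Finset.sum_sub_distrib]
      exact Finset.sum_congr rfl fun b _ => by ring
    rw [this, ← hν, h1, one_mul]
    congr 2
    simp only [rad, Finset.mul_sum]
    rw [Finset.sum_comm]
    exact Finset.sum_congr rfl fun a _ => Finset.sum_congr rfl fun b _ => by ring
  have c3 : ∑ a, y a * tangentField V f a y =
      (∑ a, V a y * V a y) + (∑ d, V d y * ∑ a, y a * pd (V a) d y)
        - ν * (ν + ∑ a, y a * ∑ b, y b * pd (V b) a y) := by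
    have e1 : ∑ a, y a * tangentField V f a y =
        (∑ a, y a * y a) * (∑ c, V c y * pd f c y) - (∑ a, y a * V a y) * rad f y := by
      simp only [tangentField, Finset.sum_mul, mul_sub, Finset.sum_sub_distrib]
      congr 1
      · exact Finset.sum_congr rfl fun b _ => by ring
      · exact Finset.sum_congr rfl fun b _ => by ring
    have e2 : ∑ c, V c y * pd f c y = (∑ a, V a y * V a y) +
        (∑ d, V d y * ∑ a, y a * pd (V a) d y) + ν * r := by
      simp only [hF, hν, mul_add, Finset.sum_add_distrib, Finset.sum_mul]
      congr 1
      exact Finset.sum_congr rfl fun b _ => by ring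
    have e3 : rad f y = ν + (∑ a, y a * ∑ b, y b * pd (V b) a y) + r := by
      simp only [rad, hF, mul_add, Finset.sum_add_distrib, ← hν, ← mul_assoc]
      rw [← Finset.sum_mul, h1, one_mul]
    rw [e1, e2, e3, h1, ← hν]; ring
  have hcs : ν ^ 2 ≤ ∑ a, V a y * V a y := by
    rw [hν]
    have := Finset.sum_mul_sq_le_sq_mul_sq Finset.univ (fun a => y a) (fun a => V a y)
    simp only [sq] at this h1 ⊢
    rw [h1, one_mul] at this
    exact this
  have hn : (1 : ℝ) ≤ n := by
    rcases Nat.eq_zero_or_pos n with h | h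
    · subst h; simp at h1
    · exact_mod_cast h
  have : ∑ a, y a * (quadField V a y - ν * rotField V a y - tangentField V f a y) =
      (∑ a, y a * quadField V a y) - ν * (∑ a, y a * rotField V a y) -
        ∑ a, y a * tangentField V f a y := by
    simp only [Finset.mul_sum, ← Finset.sum_sub_distrib]
    exact Finset.sum_congr rfl fun b _ => by ring
  rw [this, c1, c2, c3]
  nlinarith [mul_nonneg (sub_nonneg.2 hn) (sq_nonneg ν)]

/-- If `f = y · V` on the boundary, then the integral of `∂_a V^d ∂_d V^a - (∂_a V^a)²` is
controlled by the gradient of `f` and the first derivatives of `V`. -/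
theorem integral_energy_le {V : Fin n → Vec n → ℝ} (hV : ∀ a, SmoothUpTo (V a))
    {f : Vec n → ℝ} (hf : SmoothUpTo f) (hb : ∀ y ∈ bdry n, f y = ∑ a, y a * V a y) :
    ∫ y in Om n, ((∑ a, ∑ d, pd (V d) a y * pd (V a) d y) - flatDiv V y ^ 2 -
      2 * ∑ a, pd f a y * rotField V a y) ≤ 0 := by
  have hX : ∀ a, SmoothUpTo
      (fun y => quadField V a y - f y * rotField V a y - tangentField V f a y) := fun a =>
    ((SmoothUpTo.quadField hV a).sub (hf.mul (SmoothUpTo.rotField hV a))).sub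
      (SmoothUpTo.tangentField hV hf a)
  -- `rotField` is divergence free, so `f * rotField` contributes `∂f · rotField`; `tangentField`
  -- contributes the same again, whence the factor 2.
  refine le_trans (le_of_eq ?_) (integral_div_nonpos hX fun y hy => flux_nonpos hV hf hb hy)
  refine setIntegral_congr_fun measurableSet_ball fun y hy => ?_
  have hyb := om_subset_omBar hy
  have h : ∀ a, pd (fun y => quadField V a y - f y * rotField V a y - tangentField V f a y) a y
      = pd (quadField V a) a y - (pd f a y * rotField V a y + f y * pd (rotField V a) a y) -
        pd (tangentField V f a) a y := by
    intro a
    rw [pd_sub ((SmoothUpTo.quadField hV a).sub (hf.mul (SmoothUpTo.rotField hV a)))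
      (SmoothUpTo.tangentField hV hf a) a hyb, pd_sub (SmoothUpTo.quadField hV a)
      (hf.mul (SmoothUpTo.rotField hV a)) a hyb, pd_mul hf (SmoothUpTo.rotField hV a) a hyb]
  simp only [h, Finset.sum_sub_distrib, Finset.sum_add_distrib, sum_pd_quadField hV hyb,
    sum_pd_tangentField hV hf hyb, ← Finset.mul_sum, sum_pd_rotField hV hyb]
  ring

/-! ### Sums of squares of the entries of vectors and matrices -/

/-- The squared Euclidean length of a tuple. -/
noncomputable def vsq (v : Fin n → ℝ) : ℝ := ∑ a, v a ^ 2

/-- The squared Frobenius norm of a matrix. -/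
noncomputable def msq (A : Matrix (Fin n) (Fin n) ℝ) : ℝ := ∑ a, ∑ b, A a b ^ 2

lemma vsq_nonneg (v : Fin n → ℝ) : 0 ≤ vsq v := Finset.sum_nonneg fun _ _ => sq_nonneg _

lemma msq_nonneg (A : Matrix (Fin n) (Fin n) ℝ) : 0 ≤ msq A :=
  Finset.sum_nonneg fun _ _ => Finset.sum_nonneg fun _ _ => sq_nonneg _

lemma msq_transpose (A : Matrix (Fin n) (Fin n) ℝ) : msq Aᵀ = msq A := by
  unfold msq; rw [Finset.sum_comm]; rfl

lemma msq_neg (A : Matrix (Fin n) (Fin n) ℝ) : msq (-A) = msq A := by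
  simp only [msq, Matrix.neg_apply, neg_sq]

lemma msq_mul (A B : Matrix (Fin n) (Fin n) ℝ) : msq (A * B) ≤ msq A * msq B := by
  have h : msq A * msq B = ∑ a, ∑ b, (∑ c, A a c ^ 2) * ∑ c, B c b ^ 2 := by
    simp only [← Finset.mul_sum]
    rw [← Finset.sum_mul, msq, msq, Finset.sum_comm (f := fun c b => B c b ^ 2)]
  rw [h]
  refine Finset.sum_le_sum fun a _ => Finset.sum_le_sum fun b _ => ?_
  exact Finset.sum_mul_sq_le_sq_mul_sq Finset.univ (fun c => A a c) (fun c => B c b)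

lemma vsq_mulVec (A : Matrix (Fin n) (Fin n) ℝ) (v : Fin n → ℝ) :
    vsq (A *ᵥ v) ≤ msq A * vsq v := by
  unfold vsq msq
  rw [Finset.sum_mul]
  exact Finset.sum_le_sum fun a _ =>
    Finset.sum_mul_sq_le_sq_mul_sq Finset.univ (fun c => A a c) v

lemma sum_mul_le_half_add_half (A B : Matrix (Fin n) (Fin n) ℝ) :
    |∑ a, ∑ b, A a b * B a b| ≤ msq A / 2 + msq B / 2 := by
  have h : msq A / 2 + msq B / 2 = ∑ a, ∑ b, (A a b ^ 2 / 2 + B a b ^ 2 / 2) := by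
    simp only [msq, Finset.sum_div, Finset.sum_add_distrib]
  rw [h]
  refine (Finset.abs_sum_le_sum_abs _ _).trans (Finset.sum_le_sum fun a _ =>
    (Finset.abs_sum_le_sum_abs _ _).trans (Finset.sum_le_sum fun b _ => ?_))
  rw [abs_le]
  constructor <;> nlinarith [sq_nonneg (A a b + B a b), sq_nonneg (A a b - B a b)]

lemma msq_add_le (A B : Matrix (Fin n) (Fin n) ℝ) : msq (A + B) ≤ 2 * msq A + 2 * msq B := by
  have h : 2 * msq A + 2 * msq B = ∑ a, ∑ b, (2 * A a b ^ 2 + 2 * B a b ^ 2) := by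
    simp only [msq, Finset.mul_sum, Finset.sum_add_distrib]
  rw [h]
  refine Finset.sum_le_sum fun a _ => Finset.sum_le_sum fun b _ => ?_
  rw [Matrix.add_apply]
  nlinarith [sq_nonneg (A a b - B a b)]

lemma msq_sub_le (A B : Matrix (Fin n) (Fin n) ℝ) : msq (A - B) ≤ 2 * msq A + 2 * msq B := by
  have h := msq_add_le A (-B)
  rwa [msq_neg, ← sub_eq_add_neg] at h

lemma msq_smul (c : ℝ) (A : Matrix (Fin n) (Fin n) ℝ) : msq (c • A) = c ^ 2 * msq A := by
  simp only [msq, Matrix.smul_apply, smul_eq_mul, mul_pow, Finset.mul_sum]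

lemma msq_vecMulVec (u v : Fin n → ℝ) : msq (Matrix.vecMulVec u v) = vsq u * vsq v := by
  simp only [msq, Matrix.vecMulVec_apply, mul_pow, vsq, Finset.sum_mul_sum]

lemma trace_sq_le (A : Matrix (Fin n) (Fin n) ℝ) : A.trace ^ 2 ≤ n * msq A := by
  have h := sq_sum_le_card_mul_sum_sq (s := (Finset.univ : Finset (Fin n))) (f := fun a => A a a)
  rw [Finset.card_univ, Fintype.card_fin] at h
  refine h.trans (mul_le_mul_of_nonneg_left (Finset.sum_le_sum fun a _ => ?_) (Nat.cast_nonneg _))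
  exact Finset.single_le_sum (f := fun b => A a b ^ 2) (fun _ _ => sq_nonneg _)
    (Finset.mem_univ a)

lemma sq_entry_le_msq (A : Matrix (Fin n) (Fin n) ℝ) (a b : Fin n) : A a b ^ 2 ≤ msq A :=
  (Finset.single_le_sum (f := fun b => A a b ^ 2) (fun _ _ => sq_nonneg _)
    (Finset.mem_univ b)).trans (Finset.single_le_sum (f := fun a => ∑ b, A a b ^ 2)
      (fun _ _ => Finset.sum_nonneg fun _ _ => sq_nonneg _) (Finset.mem_univ a))

lemma dotProduct_sq_le (u v : Fin n → ℝ) : (∑ a, u a * v a) ^ 2 ≤ vsq u * vsq v :=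
  Finset.sum_mul_sq_le_sq_mul_sq _ _ _

/-- A matrix is controlled by the trace of its square and by its antisymmetric part with respect
to the metric `Jᵀ J`. -/
lemma msq_le_trace_sq_add {J D : Matrix (Fin n) (Fin n) ℝ} {k : ℝ} (hJ : J.det ≠ 0)
    (h1 : msq J ≤ k) (h2 : msq J⁻¹ ≤ k) :
    msq D ≤ 2 * k ^ 2 * (D * D).trace + k ^ 4 * msq (Jᵀ * J * Dᵀ - (Jᵀ * J * Dᵀ)ᵀ) := by
  have hu : IsUnit J.det := isUnit_iff_ne_zero.2 hJ
  have hk : 0 ≤ k := (msq_nonneg J).trans h1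
  set K := Jᵀ * J * Dᵀ with hK
  -- `M` is the derivative matrix in an orthonormal frame of the metric `Jᵀ J`: similarity preserves
  -- the trace of the square, and antisymmetry with respect to the metric becomes ordinary
  -- antisymmetry.
  set M := J * Dᵀ * J⁻¹ with hM
  have e1 : M - Mᵀ = J⁻¹ᵀ * (K - Kᵀ) * J⁻¹ := by
    have hl : J⁻¹ᵀ * Jᵀ = 1 := by
      rw [← Matrix.transpose_mul, Matrix.mul_nonsing_inv _ hu, Matrix.transpose_one]
    have a1 : J⁻¹ᵀ * K * J⁻¹ = M := by
      rw [hK, hM, ← Matrix.mul_assoc, ← Matrix.mul_assoc, hl, Matrix.one_mul]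
    have a2 : J⁻¹ᵀ * Kᵀ * J⁻¹ = Mᵀ := by
      rw [← a1]
      simp only [Matrix.transpose_mul, Matrix.transpose_transpose, Matrix.mul_assoc]
    rw [Matrix.mul_sub, Matrix.sub_mul, a1, a2]
  have e2 : (M * M).trace = (D * D).trace := by
    have : M * M = J * (Dᵀ * Dᵀ) * J⁻¹ := by
      rw [hM]
      calc J * Dᵀ * J⁻¹ * (J * Dᵀ * J⁻¹) = J * Dᵀ * (J⁻¹ * J) * Dᵀ * J⁻¹ := by
            simp only [Matrix.mul_assoc]
        _ = _ := by rw [Matrix.nonsing_inv_mul _ hu]; simp only [Matrix.mul_assoc, Matrix.mul_one]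
    rw [this, Matrix.trace_mul_cycle, Matrix.nonsing_inv_mul _ hu, Matrix.one_mul,
      ← Matrix.transpose_mul, Matrix.trace_transpose]
  -- The sum of the squares `M_ab²` differs from that of the products `M_ab M_ba` only through `M -
  -- Mᵀ`; half of `msq M` is then absorbed.
  have e3 : msq M = (M * M).trace - ∑ a, ∑ b, M a b * (-(M - Mᵀ)) a b := by
    have : (M * M).trace = ∑ a, ∑ b, M a b * M b a := by
      simp [Matrix.trace, Matrix.mul_apply]
    rw [this, msq]
    simp only [← Finset.sum_sub_distrib]
    refine Finset.sum_congr rfl fun a _ => Finset.sum_congr rfl fun b _ => ?_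
    simp only [Matrix.neg_apply, Matrix.sub_apply, Matrix.transpose_apply]
    ring
  have e4 : msq (-(M - Mᵀ)) ≤ k ^ 2 * msq (K - Kᵀ) := by
    rw [msq_neg, e1]
    calc msq (J⁻¹ᵀ * (K - Kᵀ) * J⁻¹) ≤ msq (J⁻¹ᵀ * (K - Kᵀ)) * msq J⁻¹ := msq_mul _ _
      _ ≤ (msq J⁻¹ᵀ * msq (K - Kᵀ)) * msq J⁻¹ :=
          mul_le_mul_of_nonneg_right (msq_mul _ _) (msq_nonneg _)
      _ ≤ (k * msq (K - Kᵀ)) * k := by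
          rw [msq_transpose]
          have := msq_nonneg (K - Kᵀ)
          have := msq_nonneg J⁻¹
          gcongr
      _ = _ := by ring
  have e5 : msq M ≤ 2 * (D * D).trace + k ^ 2 * msq (K - Kᵀ) := by
    have := (neg_abs_le _).trans' (neg_le_neg (sum_mul_le_half_add_half M (-(M - Mᵀ))))
    rw [e2] at e3
    linarith
  have e6 : msq D ≤ k ^ 2 * msq M := by
    have : Dᵀ = J⁻¹ * M * J := by
      rw [hM]
      calc Dᵀ = (J⁻¹ * J) * Dᵀ * (J⁻¹ * J) := by
            rw [Matrix.nonsing_inv_mul _ hu, Matrix.one_mul, Matrix.mul_one]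
        _ = _ := by simp only [Matrix.mul_assoc]
    rw [← msq_transpose, this]
    calc msq (J⁻¹ * M * J) ≤ msq (J⁻¹ * M) * msq J := msq_mul _ _
      _ ≤ (msq J⁻¹ * msq M) * msq J := mul_le_mul_of_nonneg_right (msq_mul _ _) (msq_nonneg _)
      _ ≤ (k * msq M) * k := by
          have := msq_nonneg M
          have := msq_nonneg J
          gcongr
      _ = _ := by ring
  calc msq D ≤ k ^ 2 * msq M := e6
    _ ≤ k ^ 2 * (2 * (D * D).trace + k ^ 2 * msq (K - Kᵀ)) := by gcongr
    _ = _ := by ring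

/-! ### The metric -/

section metric

variable {x : Vec n → Vec n} {c₁ : ℝ}

lemma smoothUpTo_jac (hx : SmoothUpTo x) (i a : Fin n) : SmoothUpTo (fun z => jac x z i a) :=
  (hx.comp_coord i).pd a

lemma smoothUpTo_metric (hx : SmoothUpTo x) (a b : Fin n) :
    SmoothUpTo (fun z => metric x z a b) := by
  simp only [metric, Matrix.mul_apply, Matrix.transpose_apply]
  exact SmoothUpTo.sum fun i => (smoothUpTo_jac hx i a).mul (smoothUpTo_jac hx i b)

lemma CoordinateCondition.msq_jac_le (hc : CoordinateCondition x c₁) {y : Vec n}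
    (hy : y ∈ OmBar n) : msq (jac x y) ≤ c₁ ^ 2 + 1 := by
  have h1 := (hc y hy).2
  have h2 := msq_nonneg (jac x y)⁻¹
  unfold msq at *; linarith

lemma CoordinateCondition.msq_jac_inv_le (hc : CoordinateCondition x c₁) {y : Vec n}
    (hy : y ∈ OmBar n) : msq (jac x y)⁻¹ ≤ c₁ ^ 2 + 1 := by
  have h1 := (hc y hy).2
  have h2 := msq_nonneg (jac x y)
  unfold msq at *; linarith

lemma CoordinateCondition.msq_metric_le (hc : CoordinateCondition x c₁) {y : Vec n}
    (hy : y ∈ OmBar n) : msq (metric x y) ≤ (c₁ ^ 2 + 1) ^ 2 := by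
  refine (msq_mul _ _).trans ?_
  rw [msq_transpose, sq]
  have := msq_nonneg (jac x y)
  have := hc.msq_jac_le hy
  gcongr

lemma det_metric (y : Vec n) : (metric x y).det = (jac x y).det ^ 2 := by
  rw [metric, Matrix.det_mul, Matrix.det_transpose, sq]

lemma CoordinateCondition.det_metric_pos (hc : CoordinateCondition x c₁) {y : Vec n}
    (hy : y ∈ OmBar n) : 0 < (metric x y).det := by
  rw [det_metric]; exact sq_pos_of_ne_zero (hc y hy).1

lemma kap_eq (y : Vec n) : kap x y = |(jac x y).det| := by
  rw [kap, det_metric, Real.sqrt_sq_eq_abs]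

lemma CoordinateCondition.kap_pos (hc : CoordinateCondition x c₁) {y : Vec n}
    (hy : y ∈ OmBar n) : 0 < kap x y := by
  rw [kap_eq]; exact abs_pos.2 (hc y hy).1

/-- An entry satisfies `A_ij² ≤ k ≤ k²`. The requirement `1 ≤ k` is the reason for using `c₁ ^ 2 +
1` throughout in place of `c₁ ^ 2`. -/
lemma abs_det_le {A : Matrix (Fin n) (Fin n) ℝ} {k : ℝ} (hk : 1 ≤ k) (h : msq A ≤ k) :
    |A.det| ≤ n.factorial * k ^ n := by
  have := Matrix.det_le (A := A) (abv := AbsoluteValue.abs) (x := k) (fun i j => by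
    change |A i j| ≤ k
    have := (sq_entry_le_msq A i j).trans h
    exact abs_le_of_sq_le_sq (by nlinarith) (by linarith))
  simpa [nsmul_eq_mul] using this

/-- A bound for the determinant of a Jacobian matrix and its inverse. -/
noncomputable def detBound (n : ℕ) (c₁ : ℝ) : ℝ := n.factorial * (c₁ ^ 2 + 1) ^ n

lemma detBound_pos (n : ℕ) (c₁ : ℝ) : 0 < detBound n c₁ := by
  unfold detBound; positivity

lemma CoordinateCondition.kap_le (hc : CoordinateCondition x c₁) {y : Vec n}
    (hy : y ∈ OmBar n) : kap x y ≤ detBound n c₁ := by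
  rw [kap_eq]
  exact abs_det_le (by nlinarith [sq_nonneg c₁]) (hc.msq_jac_le hy)

lemma CoordinateCondition.inv_kap_le (hc : CoordinateCondition x c₁) {y : Vec n}
    (hy : y ∈ OmBar n) : (kap x y)⁻¹ ≤ detBound n c₁ := by
  rw [kap_eq, ← abs_inv]
  have : ((jac x y).det)⁻¹ = ((jac x y)⁻¹).det := by
    rw [Matrix.det_nonsing_inv, Ring.inverse_eq_inv']
  rw [this]
  exact abs_det_le (by nlinarith [sq_nonneg c₁]) (hc.msq_jac_inv_le hy)

lemma abs_pd_prod_le {ι : Type*} [DecidableEq ι] {f : ι → Vec n → ℝ}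
    (hf : ∀ i, SmoothUpTo (f i)) {y : Vec n} (hy : y ∈ OmBar n) (a : Fin n) {k m : ℝ}
    (hk : 1 ≤ k) (hfk : ∀ i, |f i y| ≤ k) (hfm : ∀ i, |pd (f i) a y| ≤ m) (s : Finset ι) :
    |pd (fun z => ∏ i ∈ s, f i z) a y| ≤ s.card * k ^ s.card * m := by
  induction s using Finset.induction_on with
  | empty => simp
  | insert i s hi ih =>
    have hm : 0 ≤ m := (abs_nonneg _).trans (hfm i)
    simp only [Finset.prod_insert hi, Finset.card_insert_of_notMem hi]
    rw [pd_mul (hf i) (SmoothUpTo.prod hf) a hy]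
    have hp : |∏ i ∈ s, f i y| ≤ k ^ s.card := by
      rw [Finset.abs_prod]
      exact (Finset.prod_le_prod (fun i _ => abs_nonneg _) fun i _ => hfk i).trans_eq (by simp)
    calc |pd (f i) a y * ∏ i ∈ s, f i y + f i y * pd (fun z => ∏ i ∈ s, f i z) a y|
        ≤ |pd (f i) a y| * |∏ i ∈ s, f i y| + |f i y| * |pd (fun z => ∏ i ∈ s, f i z) a y| := by
          rw [← abs_mul, ← abs_mul]; exact abs_add_le _ _
      _ ≤ m * k ^ s.card + k * (s.card * k ^ s.card * m) := by
          have := hfk i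
          have := hfm i
          gcongr
      _ ≤ m * (k ^ s.card * k) + k * (s.card * k ^ s.card * m) := by
          gcongr
          exact le_mul_of_one_le_right (by positivity) hk
      _ = _ := by push_cast; ring

lemma abs_pd_det_le {A : Fin n → Fin n → Vec n → ℝ} (hA : ∀ i j, SmoothUpTo (A i j)) {y : Vec n}
    (hy : y ∈ OmBar n) (a : Fin n) {k m : ℝ} (hk : 1 ≤ k) (hAk : ∀ i j, |A i j y| ≤ k)
    (hAm : ∀ i j, |pd (A i j) a y| ≤ m) :
    |pd (fun z => (Matrix.of fun i j => A i j z).det) a y| ≤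
      n.factorial * (n * k ^ n * m) := by
  simp only [Matrix.det_apply', Matrix.of_apply]
  rw [pd_sum (f := fun (σ : Equiv.Perm (Fin n)) z =>
    ((Equiv.Perm.sign σ : ℤ) : ℝ) * ∏ i, A (σ i) i z)
    (fun σ => (smoothUpTo_const _).mul (SmoothUpTo.prod fun i => hA (σ i) i)) a hy]
  refine (Finset.abs_sum_le_sum_abs _ _).trans ?_
  have : ∀ σ ∈ (Finset.univ : Finset (Equiv.Perm (Fin n))),
      |pd (fun z => ((Equiv.Perm.sign σ : ℤ) : ℝ) * ∏ i, A (σ i) i z) a y| ≤ n * k ^ n * m := by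
    intro σ _
    rw [pd_mul (smoothUpTo_const _) (SmoothUpTo.prod fun i => hA (σ i) i) a hy, pd_const,
      zero_mul, zero_add, abs_mul]
    have h1 : |((Equiv.Perm.sign σ : ℤ) : ℝ)| = 1 := by
      rcases Int.units_eq_one_or (Equiv.Perm.sign σ) with h | h <;> simp [h]
    rw [h1, one_mul]
    have := abs_pd_prod_le (f := fun i => A (σ i) i) (fun i => hA (σ i) i) hy a hk
      (fun i => hAk _ _) (fun i => hAm _ _) Finset.univ
    simpa using this
  refine (Finset.sum_le_card_nsmul _ _ _ this).trans (le_of_eq ?_)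
  simp [Finset.card_univ, Fintype.card_perm]

lemma continuousOn_metricDeriv (hx : SmoothUpTo x) : ContinuousOn (fun y =>
    Real.sqrt (∑ c, ∑ a, ∑ b, (pd (fun z => metric x z a b) c y) ^ 2)) (OmBar n) := by
  apply ContinuousOn.sqrt
  refine continuousOn_finsetSum _ fun c _ => continuousOn_finsetSum _ fun a _ =>
    continuousOn_finsetSum _ fun b _ => ?_
  exact ((smoothUpTo_metric hx a b).pd c).continuousOn.pow 2

lemma one_le_metricBracket : 1 ≤ metricBracket x :=
  le_add_of_nonneg_right (Real.iSup_nonneg fun _ => Real.sqrt_nonneg _)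

lemma sum_sq_pd_metric_le (hx : SmoothUpTo x) {y : Vec n} (hy : y ∈ OmBar n) :
    ∑ c, ∑ a, ∑ b, (pd (fun z => metric x z a b) c y) ^ 2 ≤ metricBracket x ^ 2 := by
  obtain ⟨C, -, hC⟩ := exists_abs_le_of_continuousOn (continuousOn_metricDeriv hx)
  -- The real supremum of an unbounded family is 0 by convention, so boundedness has to be
  -- established before the supremum bounds anything.
  have hbdd : BddAbove (Set.range fun y : OmBar n =>
      Real.sqrt (∑ c, ∑ a, ∑ b, (pd (fun z => metric x z a b) c (y : Vec n)) ^ 2)) :=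
    ⟨C, by rintro _ ⟨z, rfl⟩; exact (le_abs_self _).trans (hC z z.2)⟩
  have h := le_ciSup hbdd ⟨y, hy⟩
  refine (Real.sqrt_le_left (zero_le_one.trans one_le_metricBracket)).1 (h.trans ?_)
  exact le_add_of_nonneg_left zero_le_one

lemma abs_pd_metric_le (hx : SmoothUpTo x) {y : Vec n} (hy : y ∈ OmBar n) (a b c : Fin n) :
    |pd (fun z => metric x z a b) c y| ≤ metricBracket x := by
  refine abs_le_of_sq_le_sq ?_ (zero_le_one.trans one_le_metricBracket)
  refine le_trans ?_ (sum_sq_pd_metric_le hx hy)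
  have h1 := sq_entry_le_msq (Matrix.of fun a b => pd (fun z => metric x z a b) c y) a b
  exact h1.trans (Finset.single_le_sum
    (f := fun c => msq (Matrix.of fun a b => pd (fun z => metric x z a b) c y))
    (fun _ _ => msq_nonneg _) (Finset.mem_univ c))

lemma smoothUpTo_det_metric (hx : SmoothUpTo x) : SmoothUpTo (fun z => (metric x z).det) := by
  simp only [Matrix.det_apply']
  exact SmoothUpTo.sum fun σ => (smoothUpTo_const _).mul
    (SmoothUpTo.prod fun i => smoothUpTo_metric hx _ _)

lemma smoothUpTo_kap (hx : SmoothUpTo x) (hc : CoordinateCondition x c₁) :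
    SmoothUpTo (kap x) :=
  (smoothUpTo_det_metric hx).sqrt fun _ hy => (hc.det_metric_pos hy).ne'

/-- A bound for the logarithmic derivative of the volume density. -/
noncomputable def logKapBound (n : ℕ) (c₁ : ℝ) : ℝ :=
  detBound n c₁ ^ 2 * (n.factorial * (n * ((c₁ ^ 2 + 1)) ^ n))

/-- From `κ² = det g` one has `κ⁻¹ ∂κ = ∂(det g) / (2 κ²)`, and the derivative of the determinant is
linear in `∂g`. -/
lemma abs_pd_kap_div_le (hx : SmoothUpTo x) (hc : CoordinateCondition x c₁) {y : Vec n}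
    (hy : y ∈ OmBar n) (a : Fin n) :
    |(kap x y)⁻¹ * pd (kap x) a y| ≤ logKapBound n c₁ * metricBracket x := by
  have hk := hc.kap_pos hy
  have hsq : pd (fun z => (metric x z).det) a y = 2 * kap x y * pd (kap x) a y := by
    have h := pd_congr (f := fun z => (metric x z).det) (g := fun z => kap x z * kap x z)
      (fun z hz => (Real.mul_self_sqrt (hc.det_metric_pos hz).le).symm) a hy
    rw [h, pd_mul (smoothUpTo_kap hx hc) (smoothUpTo_kap hx hc) a hy]; ring
  have h1 : (kap x y)⁻¹ * pd (kap x) a y =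
      (kap x y)⁻¹ ^ 2 * (pd (fun z => (metric x z).det) a y / 2) := by
    rw [hsq]; field_simp
  have hb := abs_pd_det_le (A := fun a b z => metric x z a b) (smoothUpTo_metric hx) hy a
    (k := c₁ ^ 2 + 1) (m := metricBracket x) (by nlinarith [sq_nonneg c₁])
    (fun i j => abs_le_of_sq_le_sq ((sq_entry_le_msq _ i j).trans (hc.msq_metric_le hy))
      (by positivity)) (fun i j => abs_pd_metric_le hx hy i j a)
  have hb' : |pd (fun z => (metric x z).det) a y| ≤
      n.factorial * (n * (c₁ ^ 2 + 1) ^ n * metricBracket x) := hb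
  have hi := hc.inv_kap_le hy
  have hi0 : 0 ≤ (kap x y)⁻¹ := (inv_pos.2 hk).le
  rw [h1, abs_mul, abs_of_nonneg (sq_nonneg _), abs_div, abs_two]
  calc (kap x y)⁻¹ ^ 2 * (|pd (fun z => (metric x z).det) a y| / 2)
      ≤ detBound n c₁ ^ 2 * |pd (fun z => (metric x z).det) a y| := by
        have := abs_nonneg (pd (fun z => (metric x z).det) a y)
        gcongr
        linarith
    _ ≤ detBound n c₁ ^ 2 * (n.factorial * (n * (c₁ ^ 2 + 1) ^ n * metricBracket x)) := by
        gcongr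
    _ = _ := by rw [logKapBound]; ring

/-- The energy inequality involves the flat divergence; it differs from the metric one by `W^a ∂_a
log κ`, a term of order zero. -/
lemma divergence_eq (hx : SmoothUpTo x) (hc : CoordinateCondition x c₁) {W : Vec n → Vec n}
    (hW : SmoothUpTo W) {y : Vec n} (hy : y ∈ OmBar n) :
    divergence x W y = (partials W y).trace + ∑ a, ((kap x y)⁻¹ * pd (kap x) a y) * W y a := by
  have hk := (hc.kap_pos hy).ne'
  unfold divergence
  simp only [fun a => pd_mul (smoothUpTo_kap hx hc) (hW.comp_coord a) a hy,
    Finset.sum_add_distrib, ← Finset.mul_sum, mul_add]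
  rw [← mul_assoc, inv_mul_cancel₀ hk, one_mul, Finset.mul_sum, add_comm]
  simp only [mul_assoc]
  rfl

lemma trace_partials_sq_le (hx : SmoothUpTo x) (hc : CoordinateCondition x c₁)
    {W : Vec n → Vec n} (hW : SmoothUpTo W) {y : Vec n} (hy : y ∈ OmBar n) :
    (partials W y).trace ^ 2 ≤ 2 * divergence x W y ^ 2 +
      2 * n * logKapBound n c₁ ^ 2 * metricBracket x ^ 2 * vsq (W y) := by
  have h := divergence_eq hx hc hW hy
  have h2 := dotProduct_sq_le (fun a => (kap x y)⁻¹ * pd (kap x) a y) (W y)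
  have h3 : vsq (fun a => (kap x y)⁻¹ * pd (kap x) a y) ≤
      n * (logKapBound n c₁ * metricBracket x) ^ 2 := by
    have := Finset.sum_le_card_nsmul Finset.univ
      (fun a => ((kap x y)⁻¹ * pd (kap x) a y) ^ 2) _
      (fun a _ => sq_le_sq' (abs_le.1 (abs_pd_kap_div_le hx hc hy a)).1
        (abs_le.1 (abs_pd_kap_div_le hx hc hy a)).2)
    simpa [nsmul_eq_mul, vsq] using this
  have h4 := mul_le_mul_of_nonneg_right h3 (vsq_nonneg (W y))
  set s := ∑ a, ((kap x y)⁻¹ * pd (kap x) a y) * W y a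
  have h5 : (partials W y).trace = divergence x W y - s := by linarith
  rw [h5]
  nlinarith [sq_nonneg (divergence x W y + s)]

/-- The antisymmetric part of `g_{bc} ∂_a W^c` is the curl up to terms of order zero. -/
lemma msq_antisymm_le (hx : SmoothUpTo x) {W : Vec n → Vec n} (hW : SmoothUpTo W) {y : Vec n}
    (hy : y ∈ OmBar n) :
    msq (metric x y * (partials W y)ᵀ - (metric x y * (partials W y)ᵀ)ᵀ) ≤
      2 * msq (curl (lower x W) y) + 8 * metricBracket x ^ 2 * vsq (W y) := by
  set K := metric x y * (partials W y)ᵀ with hK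
  set R : Matrix (Fin n) (Fin n) ℝ :=
    Matrix.of fun a b => ∑ c, pd (fun z => metric x z b c) a y * W y c with hR
  have h1 : ∀ a b, pd (fun z => lower x W z b) a y = R a b + K b a := by
    intro a b
    have e : (fun z => lower x W z b) = fun z => ∑ c, metric x z b c * W z c := rfl
    rw [e, pd_sum (fun c => (smoothUpTo_metric hx b c).mul (hW.comp_coord c)) a hy]
    simp only [fun c => pd_mul (smoothUpTo_metric hx b c) (hW.comp_coord c) a hy,
      Finset.sum_add_distrib]
    rfl
  have h2 : K - Kᵀ = (-(curl (lower x W) y) + (R - Rᵀ)) := by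
    ext a b
    simp only [Matrix.sub_apply, Matrix.transpose_apply, Matrix.add_apply, Matrix.neg_apply,
      curl, Matrix.of_apply, h1]
    ring
  have h3 : msq R ≤ metricBracket x ^ 2 * vsq (W y) := by
    refine le_trans ?_ (mul_le_mul_of_nonneg_right (sum_sq_pd_metric_le hx hy) (vsq_nonneg _))
    simp only [Finset.sum_mul, msq]
    refine Finset.sum_le_sum fun a _ => Finset.sum_le_sum fun b _ => ?_
    rw [← Finset.sum_mul]
    exact dotProduct_sq_le _ _
  have h4 := msq_neg (curl (lower x W) y)
  have h5 := msq_add_le (-(curl (lower x W) y)) (R - Rᵀ)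
  have h6 := msq_sub_le R Rᵀ
  rw [msq_transpose] at h6
  rw [h2]
  linarith

end metric

/-! ### The estimate for the derivatives of a multiple of a vector field -/

section multiplier

variable {x : Vec n → Vec n} {c₁ : ℝ}

lemma vsq_add_le (u v : Fin n → ℝ) : vsq (u + v) ≤ 2 * vsq u + 2 * vsq v := by
  simp only [vsq, Finset.mul_sum, ← Finset.sum_add_distrib, Pi.add_apply]
  exact Finset.sum_le_sum fun a _ => by nlinarith [sq_nonneg (u a - v a)]

lemma vsq_le_one {y : Vec n} (hy : y ∈ OmBar n) : vsq y ≤ 1 := by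
  have h : ‖y‖ ≤ 1 := by simpa using hy
  have := EuclideanSpace.real_norm_sq_eq y
  unfold vsq
  nlinarith [norm_nonneg y]

lemma vsq_rotField_le {V : Fin n → Vec n → ℝ} {y : Vec n} (hy : y ∈ OmBar n)
    {D : Matrix (Fin n) (Fin n) ℝ} (hD : ∀ a b, D a b = pd (V b) a y) :
    vsq (fun a => rotField V a y) ≤
      3 * (n + 1) ^ 2 * (vsq (fun a => V a y) + msq D) := by
  have h1 : vsq (fun a => rad (V a) y) ≤ msq D := by
    have e : (fun a => rad (V a) y) = Dᵀ *ᵥ y := by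
      ext a
      simp [rad, Matrix.mulVec, dotProduct, hD, mul_comm]
    rw [e]
    refine (vsq_mulVec _ _).trans ?_
    rw [msq_transpose]
    exact mul_le_of_le_one_right (msq_nonneg _) (vsq_le_one hy)
  have h2 : vsq (fun a => y a * flatDiv V y) ≤ n * msq D := by
    have e : flatDiv V y = D.trace := by simp [flatDiv, Matrix.trace, hD]
    have e2 : vsq (fun a => y a * flatDiv V y) = vsq y * D.trace ^ 2 := by
      rw [e]; simp only [vsq, mul_pow, Finset.sum_mul]
    rw [e2]
    exact (mul_le_of_le_one_left (sq_nonneg _) (vsq_le_one hy)).trans (trace_sq_le D)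
  have h3 : vsq (fun a => rotField V a y) ≤ 3 * ((n - 1) ^ 2 * vsq (fun a => V a y)) +
      3 * vsq (fun a => rad (V a) y) + 3 * vsq (fun a => y a * flatDiv V y) := by
    simp only [vsq, Finset.mul_sum, ← Finset.sum_add_distrib]
    refine Finset.sum_le_sum fun a _ => ?_
    unfold rotField
    set p := ((n : ℝ) - 1) * V a y with hp
    rw [← mul_pow, ← hp]
    nlinarith [sq_nonneg (p - rad (V a) y), sq_nonneg (p + y a * flatDiv V y),
      sq_nonneg (rad (V a) y + y a * flatDiv V y)]
  have hn : (0 : ℝ) ≤ n := Nat.cast_nonneg n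
  have hv := vsq_nonneg (fun a => V a y)
  have hm := msq_nonneg D
  nlinarith [mul_nonneg hn hv, mul_nonneg hn hm, mul_nonneg (mul_nonneg hn hn) hm]

/-- The constant of the estimate for the derivatives of a multiple of a vector field. -/
noncomputable def multConst (n : ℕ) (c₁ : ℝ) : ℝ :=
  96 * (c₁ ^ 2 + 1) ^ 4 * (n + 1) ^ 2 + 32 * (c₁ ^ 2 + 1) ^ 2 + 16 * (c₁ ^ 2 + 1) ^ 4 +
    (16 * (c₁ ^ 2 + 1) ^ 2 * (2 * n * logKapBound n c₁ ^ 2) + 2 + 64 * (c₁ ^ 2 + 1) ^ 4) +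
    (16 * (c₁ ^ 2 + 1) ^ 2 + 32 * (c₁ ^ 2 + 1) ^ 6 + 2)

lemma multConst_pos (n : ℕ) (c₁ : ℝ) : 0 < multConst n c₁ := by
  unfold multConst; positivity

/-- The absorption: `2 m` is written as `4 m - 2 m`, `e1` is applied to the first part, and four
times `e3` bounds the resulting `16 k² FP` at the cost of exactly `2 m`, which the second part
cancels. -/
lemma collect_multiplier_terms {k N m d A T FP F2 φ vW v B Λ G L q s t : ℝ} (hN : 0 ≤ N) (hvW : 0 ≤ vW) (hq : 0 ≤ q) (hs : 0 ≤ s) (hF2 : 0 ≤ F2) (hL : 0 ≤ L)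
    (hB : 0 ≤ B) (hΛ : 0 ≤ Λ)
    (e1 : m ≤ 2 * k ^ 2 * T + k ^ 4 * A) (e2 : φ * d ≤ 2 * m + 2 * (v * vW))
    (e3 : 4 * k ^ 2 * FP ≤ 24 * k ^ 4 * N * F2 + (φ * vW + m) / 2)
    (i1 : t ^ 2 ≤ 2 * (B * (2 * s + L * G ^ 2 * vW)) + 2 * (Λ * vW))
    (i2 : A ≤ 2 * (B * (2 * q + 8 * G ^ 2 * vW)) + 8 * (k ^ 2 * vW * Λ))
    (i3 : φ * vW ≤ B * G ^ 2 * vW) (i4 : v * vW ≤ Λ * vW) :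
    φ * d ≤ 8 * k ^ 2 * (T - t ^ 2 - 2 * FP) +
      (96 * k ^ 4 * N + 32 * k ^ 2 + 16 * k ^ 4 + (16 * k ^ 2 * L + 2 + 64 * k ^ 4) +
        (16 * k ^ 2 + 32 * k ^ 6 + 2)) * (F2 + B * (q + s) + (Λ + B * G ^ 2) * vW) := by
  have i5 := mul_le_mul_of_nonneg_left i1 (by positivity : 0 ≤ 8 * k ^ 2)
  have i6 := mul_le_mul_of_nonneg_left i2 (by positivity : 0 ≤ 4 * k ^ 4)
  have main : φ * d ≤ 8 * k ^ 2 * (T - t ^ 2 - 2 * FP) +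
        (96 * k ^ 4 * N * F2 + 32 * k ^ 2 * (B * s) + 16 * k ^ 4 * (B * q) +
          (16 * k ^ 2 * L + 2 + 64 * k ^ 4) * (B * G ^ 2 * vW) +
          (16 * k ^ 2 + 32 * k ^ 6 + 2) * (Λ * vW)) := by
    linarith
  refine main.trans (add_le_add_right ?_ _)
  set c1 := 96 * k ^ 4 * N
  set c2 := 32 * k ^ 2
  set c3 := 16 * k ^ 4
  set c4 := 16 * k ^ 2 * L + 2 + 64 * k ^ 4
  set c5 := 16 * k ^ 2 + 32 * k ^ 6 + 2
  have h1 : 0 ≤ c1 := by positivity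
  have h2 : 0 ≤ c2 := by positivity
  have h3 : 0 ≤ c3 := by positivity
  have h4 : 0 ≤ c4 := by positivity
  have h5 : 0 ≤ c5 := by positivity
  calc _ ≤ (c1 + c2 + c3 + c4 + c5) * F2 + (c1 + c2 + c3 + c4 + c5) * (B * s) +
        (c1 + c2 + c3 + c4 + c5) * (B * q) + (c1 + c2 + c3 + c4 + c5) * (B * G ^ 2 * vW) +
        (c1 + c2 + c3 + c4 + c5) * (Λ * vW) := by
        gcongr <;> linarith
    _ = _ := by ring

/-- The energy density of `V = φ W` is kept intact on the right, since only its integral has a sign.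
`Λ` and `B` bound the cost of commuting `φ` with derivatives. -/
lemma pointwise_multiplier_le (hx : SmoothUpTo x) (hc : CoordinateCondition x c₁)
    {W : Vec n → Vec n} (hW : SmoothUpTo W) {φ f : Vec n → ℝ} (hφ : SmoothUpTo φ)
    {B Λ : ℝ} {y : Vec n} (hy : y ∈ OmBar n) (hB : φ y ^ 2 ≤ B)
    (hΛ : vsq (fun a => pd φ a y) ≤ Λ) :
    φ y ^ 2 * msq (partials W y) ≤
      8 * (c₁ ^ 2 + 1) ^ 2 *
        ((∑ a, ∑ d, pd (fun z => φ z * W z d) a y * pd (fun z => φ z * W z a) d y) -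
          flatDiv (fun a z => φ z * W z a) y ^ 2 -
          2 * ∑ a, pd f a y * rotField (fun a z => φ z * W z a) a y) +
      multConst n c₁ * (vsq (fun a => pd f a y) +
        B * (msq (curl (lower x W) y) + divergence x W y ^ 2) +
        (Λ + B * metricBracket x ^ 2) * vsq (W y)) := by
  set k := c₁ ^ 2 + 1 with hk
  set V : Fin n → Vec n → ℝ := fun a z => φ z * W z a with hV
  set D := partials W y with hD
  set dφ : Fin n → ℝ := fun a => pd φ a y with hdφ
  set DV := Matrix.vecMulVec dφ (W y) + φ y • D with hDV
  have hDV' : ∀ a b, DV a b = pd (V b) a y := by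
    intro a b
    rw [hV, pd_mul hφ (hW.comp_coord b) a hy]
    rfl
  have e1 := msq_le_trace_sq_add (D := DV) (hc y hy).1 (hc.msq_jac_le hy) (hc.msq_jac_inv_le hy)
  rw [← hk] at e1
  change msq DV ≤ 2 * k ^ 2 * (DV * DV).trace +
    k ^ 4 * msq (metric x y * DVᵀ - (metric x y * DVᵀ)ᵀ) at e1
  set A := metric x y * Dᵀ - (metric x y * Dᵀ)ᵀ with hA
  set w := metric x y *ᵥ W y with hw
  have e2 : metric x y * DVᵀ - (metric x y * DVᵀ)ᵀ =
      φ y • A + (Matrix.vecMulVec w dφ - (Matrix.vecMulVec w dφ)ᵀ) := by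
    have : metric x y * DVᵀ = φ y • (metric x y * Dᵀ) + Matrix.vecMulVec w dφ := by
      rw [hDV, Matrix.transpose_add, Matrix.transpose_vecMulVec, Matrix.mul_add,
        Matrix.transpose_smul, Matrix.mul_smul, Matrix.mul_vecMulVec, add_comm]
    rw [this, hA, Matrix.transpose_add, Matrix.transpose_smul, smul_sub]
    abel
  have e3 := msq_add_le (φ y • A) (Matrix.vecMulVec w dφ - (Matrix.vecMulVec w dφ)ᵀ)
  have e4 := msq_sub_le (Matrix.vecMulVec w dφ) (Matrix.vecMulVec w dφ)ᵀ
  rw [msq_transpose, msq_vecMulVec] at e4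
  rw [← e2, msq_smul] at e3
  have e5 := msq_antisymm_le hx hW hy
  have e6 : vsq w ≤ k ^ 2 * vsq (W y) :=
    (vsq_mulVec _ _).trans (mul_le_mul_of_nonneg_right (hc.msq_metric_le hy) (vsq_nonneg _))
  have e7 := trace_partials_sq_le hx hc hW hy
  have e8 : flatDiv V y = φ y * D.trace + ∑ a, dφ a * W y a := by
    have : flatDiv V y = DV.trace := by simp [flatDiv, Matrix.trace, hDV']
    rw [this, hDV, Matrix.trace_add, Matrix.trace_smul, Matrix.trace_vecMulVec, smul_eq_mul,
      add_comm]
    rfl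
  have e9 := dotProduct_sq_le dφ (W y)
  have e10 := vsq_rotField_le hy hDV'
  have e11 : ∑ a, ∑ d, pd (V d) a y * pd (V a) d y = (DV * DV).trace := by
    simp [Matrix.trace, Matrix.mul_apply, hDV']
  have e12 : vsq (fun a => V a y) = φ y ^ 2 * vsq (W y) := by
    simp only [hV, vsq, mul_pow, Finset.mul_sum]
  have e13 : φ y ^ 2 * msq D ≤ 2 * msq DV + 2 * (vsq dφ * vsq (W y)) := by
    have := msq_sub_le DV (Matrix.vecMulVec dφ (W y))
    rwa [hDV, add_sub_cancel_left, msq_smul, msq_vecMulVec] at this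
  have e14 : 4 * k ^ 2 * ∑ a, pd f a y * rotField V a y ≤
      24 * k ^ 4 * (n + 1) ^ 2 * vsq (fun a => pd f a y) +
        (vsq (fun a => V a y) + msq DV) / 2 := by
    -- Young's inequality; the weight `6 (n + 1)²` is twice the constant of `vsq_rotField_le`, so
    -- that half of `msq DV` appears.
    have hs : 4 * k ^ 2 * ∑ a, pd f a y * rotField V a y ≤
        24 * k ^ 4 * (n + 1) ^ 2 * vsq (fun a => pd f a y) +
          vsq (fun a => rotField V a y) / (6 * (n + 1) ^ 2) := by
      simp only [vsq, Finset.mul_sum, Finset.sum_div, ← Finset.sum_add_distrib]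
      refine Finset.sum_le_sum fun a _ => ?_
      have hm : (0 : ℝ) < (n + 1) ^ 2 := by positivity
      set P := rotField V a y
      set F := pd f a y
      have : 0 ≤ (12 * k ^ 2 * ((n : ℝ) + 1) ^ 2 * F - P) ^ 2 / (6 * (n + 1) ^ 2) := by positivity
      have h2 : (12 * k ^ 2 * ((n : ℝ) + 1) ^ 2 * F - P) ^ 2 / (6 * (n + 1) ^ 2) =
          24 * k ^ 4 * (n + 1) ^ 2 * F ^ 2 + P ^ 2 / (6 * (n + 1) ^ 2) - 4 * k ^ 2 * (F * P) := by
        field_simp; ring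
      linarith
    refine hs.trans (add_le_add_right ?_ _)
    rw [div_le_iff₀ (by positivity)]
    linarith only [e10]
  rw [e11]
  set G := metricBracket x
  have hG : 1 ≤ G := one_le_metricBracket
  have hvW : 0 ≤ vsq (W y) := vsq_nonneg _
  have hφ2 : 0 ≤ φ y ^ 2 := sq_nonneg _
  have hB0 : 0 ≤ B := hφ2.trans hB
  have hv' : 0 ≤ vsq dφ := vsq_nonneg _
  have hΛ0 : 0 ≤ Λ := hv'.trans hΛ
  have i1 : flatDiv V y ^ 2 ≤ 2 * (B * (2 * divergence x W y ^ 2 + 2 * n * logKapBound n c₁ ^ 2 * G ^ 2 * vsq (W y))) + 2 * (Λ * vsq (W y)) := by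
    have a1 : flatDiv V y ^ 2 ≤ 2 * (φ y ^ 2 * D.trace ^ 2) + 2 * (∑ a, dφ a * W y a) ^ 2 := by
      rw [e8]; linarith only [sq_nonneg (φ y * D.trace - ∑ a, dφ a * W y a)]
    have a2 : φ y ^ 2 * D.trace ^ 2 ≤ B * (2 * divergence x W y ^ 2 + 2 * n * logKapBound n c₁ ^ 2 * G ^ 2 * vsq (W y)) :=
      mul_le_mul hB e7 (sq_nonneg _) hB0
    have a3 : vsq dφ * vsq (W y) ≤ Λ * vsq (W y) := mul_le_mul_of_nonneg_right hΛ hvW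
    linarith only [a1, a2, a3, e9]
  have i2 : msq (metric x y * DVᵀ - (metric x y * DVᵀ)ᵀ) ≤
      2 * (B * (2 * msq (curl (lower x W) y) + 8 * G ^ 2 * vsq (W y))) + 8 * (k ^ 2 * vsq (W y) * Λ) := by
    have a1 : φ y ^ 2 * msq A ≤ B * (2 * msq (curl (lower x W) y) + 8 * G ^ 2 * vsq (W y)) :=
      mul_le_mul hB e5 (msq_nonneg _) hB0
    have a2 : vsq w * vsq dφ ≤ k ^ 2 * vsq (W y) * Λ := mul_le_mul e6 hΛ hv' (by positivity)
    linarith only [a1, a2, e3, e4]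
  have i3 : φ y ^ 2 * vsq (W y) ≤ B * G ^ 2 * vsq (W y) := by
    refine mul_le_mul_of_nonneg_right (hB.trans (le_mul_of_one_le_right hB0 ?_)) hvW
    nlinarith only [hG]
  have i4 : vsq dφ * vsq (W y) ≤ Λ * vsq (W y) := mul_le_mul_of_nonneg_right hΛ hvW
  rw [e12] at e14
  exact collect_multiplier_terms (by positivity) hvW (msq_nonneg _) (sq_nonneg _)
    (vsq_nonneg _) (by positivity) hB0 hΛ0 e1 e13 e14 i1 i2 i3 i4

lemma continuousOn_msq {T : Vec n → Matrix (Fin n) (Fin n) ℝ}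
    (h : ∀ a b, ContinuousOn (fun y => T y a b) (OmBar n)) :
    ContinuousOn (fun y => msq (T y)) (OmBar n) :=
  continuousOn_finsetSum _ fun a _ => continuousOn_finsetSum _ fun b _ => (h a b).pow 2

lemma continuousOn_vsq {T : Vec n → Fin n → ℝ}
    (h : ∀ a, ContinuousOn (fun y => T y a) (OmBar n)) :
    ContinuousOn (fun y => vsq (T y)) (OmBar n) :=
  continuousOn_finsetSum _ fun a _ => (h a).pow 2

lemma smoothUpTo_lower (hx : SmoothUpTo x) {W : Vec n → Vec n} (hW : SmoothUpTo W) (a : Fin n) :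
    SmoothUpTo (fun z => lower x W z a) := by
  have : (fun z => lower x W z a) = fun z => ∑ c, metric x z a c * W z c := rfl
  rw [this]
  exact SmoothUpTo.sum fun c => (smoothUpTo_metric hx a c).mul (hW.comp_coord c)

lemma continuousOn_msq_curl (hx : SmoothUpTo x) {W : Vec n → Vec n} (hW : SmoothUpTo W) :
    ContinuousOn (fun y => msq (curl (lower x W) y)) (OmBar n) :=
  continuousOn_msq fun a b => (((smoothUpTo_lower hx hW b).pd a).sub
    ((smoothUpTo_lower hx hW a).pd b)).continuousOn

lemma continuousOn_divergence (hx : SmoothUpTo x) (hc : CoordinateCondition x c₁)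
    {W : Vec n → Vec n} (hW : SmoothUpTo W) : ContinuousOn (divergence x W) (OmBar n) :=
  ((smoothUpTo_kap hx hc).continuousOn.inv₀ fun _ hy => (hc.kap_pos hy).ne').mul
    (SmoothUpTo.sum (s := Finset.univ) fun a =>
      ((smoothUpTo_kap hx hc).mul (hW.comp_coord a)).pd a).continuousOn

lemma continuousOn_msq_partials {W : Vec n → Vec n} (hW : SmoothUpTo W) :
    ContinuousOn (fun y => msq (partials W y)) (OmBar n) :=
  continuousOn_msq fun a b => ((hW.comp_coord b).pd a).continuousOn

theorem integral_multiplier_le (hx : SmoothUpTo x) (hc : CoordinateCondition x c₁)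
    {W : Vec n → Vec n} (hW : SmoothUpTo W) {φ f : Vec n → ℝ} (hφ : SmoothUpTo φ)
    (hf : SmoothUpTo f) {B Λ : ℝ} (hB : ∀ y ∈ OmBar n, φ y ^ 2 ≤ B)
    (hΛ : ∀ y ∈ OmBar n, vsq (fun a => pd φ a y) ≤ Λ)
    (hb : ∀ y ∈ bdry n, f y = φ y * ∑ a, y a * W y a) :
    ∫ y in Om n, φ y ^ 2 * msq (partials W y) ≤
      multConst n c₁ * ((∫ y in Om n, vsq (fun a => pd f a y)) +
        B * ((∫ y in Om n, msq (curl (lower x W) y)) + ∫ y in Om n, divergence x W y ^ 2) +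
        (Λ + B * metricBracket x ^ 2) * ∫ y in Om n, vsq (W y)) := by
  have hV : ∀ a, SmoothUpTo (fun z => φ z * W z a) := fun a => hφ.mul (hW.comp_coord a)
  have hE := integral_energy_le hV hf (fun y hy => by
    rw [hb y hy, Finset.mul_sum]; exact Finset.sum_congr rfl fun a _ => by ring)
  set E : Vec n → ℝ := fun y =>
    (∑ a, ∑ d, pd (fun z => φ z * W z d) a y * pd (fun z => φ z * W z a) d y) -
          flatDiv (fun a z => φ z * W z a) y ^ 2 -
          2 * ∑ a, pd f a y * rotField (fun a z => φ z * W z a) a y with hEdef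
  have cE : IntegrableOn E (Om n) := by
    apply integrableOn_of_continuousOn
    refine ((continuousOn_finsetSum _ fun a _ => continuousOn_finsetSum _ fun d _ => ?_).sub
      ((SmoothUpTo.flatDiv hV).continuousOn.pow 2)).sub
      (continuousOn_const.mul (continuousOn_finsetSum _ fun a _ => ?_))
    · exact ((hV d).pd a).continuousOn.mul ((hV a).pd d).continuousOn
    · exact (hf.pd a).continuousOn.mul (SmoothUpTo.rotField hV a).continuousOn
  have c1 : IntegrableOn (fun y => vsq (fun a => pd f a y)) (Om n) :=
    integrableOn_of_continuousOn (continuousOn_vsq fun a => (hf.pd a).continuousOn)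
  have c2 := integrableOn_of_continuousOn (continuousOn_msq_curl hx hW)
  have c3 : IntegrableOn (fun y => divergence x W y ^ 2) (Om n) :=
    integrableOn_of_continuousOn ((continuousOn_divergence hx hc hW).pow 2)
  have c4 : IntegrableOn (fun y => vsq (W y)) (Om n) :=
    integrableOn_of_continuousOn (continuousOn_vsq fun a => (hW.comp_coord a).continuousOn)
  have c5 : IntegrableOn (fun y => φ y ^ 2 * msq (partials W y)) (Om n) :=
    integrableOn_of_continuousOn ((hφ.continuousOn.pow 2).mul (continuousOn_msq_partials hW))
  have c23 : IntegrableOn (fun y => B * (msq (curl (lower x W) y) + divergence x W y ^ 2))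
    (Om n) := (c2.add c3).const_mul B
  have c4' : IntegrableOn (fun y => (Λ + B * metricBracket x ^ 2) * vsq (W y)) (Om n) :=
    c4.const_mul _
  have c6 : IntegrableOn (fun y => vsq (fun a => pd f a y) +
        B * (msq (curl (lower x W) y) + divergence x W y ^ 2) +
        (Λ + B * metricBracket x ^ 2) * vsq (W y)) (Om n) := (c1.add c23).add c4'
  have h := setIntegral_mono_on c5 ((cE.const_mul (8 * (c₁ ^ 2 + 1) ^ 2)).add
    (c6.const_mul (multConst n c₁))) measurableSet_ball fun y hy =>
      pointwise_multiplier_le hx hc hW (f := f) hφ (om_subset_omBar hy)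
        (hB y (om_subset_omBar hy)) (hΛ y (om_subset_omBar hy))
  refine h.trans ?_
  rw [integral_add' (cE.const_mul _) (c6.const_mul _), integral_const_mul, integral_const_mul]
  have e : ∫ y in Om n, (vsq (fun a => pd f a y) +
        B * (msq (curl (lower x W) y) + divergence x W y ^ 2) +
        (Λ + B * metricBracket x ^ 2) * vsq (W y)) =
      (∫ y in Om n, vsq (fun a => pd f a y)) +
        B * ((∫ y in Om n, msq (curl (lower x W) y)) + ∫ y in Om n, divergence x W y ^ 2) +
        (Λ + B * metricBracket x ^ 2) * ∫ y in Om n, vsq (W y) := by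
    have c123 : IntegrableOn (fun y => vsq (fun a => pd f a y) +
        B * (msq (curl (lower x W) y) + divergence x W y ^ 2)) (Om n) := c1.add c23
    rw [integral_add c123 c4',
      integral_add c1 c23, integral_const_mul, integral_const_mul,
      integral_add c2 c3]
  rw [e]
  -- The energy integral is nonpositive and is discarded.
  have := mul_nonpos_of_nonneg_of_nonpos
    (by positivity : (0 : ℝ) ≤ 8 * (c₁ ^ 2 + 1) ^ 2) hE
  linarith

end multiplier

/-! ### Normal derivatives of functions that vanish on the boundary -/

section normal

variable {x : Vec n → Vec n} {c₁ : ℝ}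

/-- The squared length of the conormal `y` in the metric `g`. -/
noncomputable def conormalSq (x : Vec n → Vec n) (y : Vec n) : ℝ :=
  ∑ b, ∑ c, (metric x y)⁻¹ b c * y b * y c

/-- With `J` the Jacobian matrix, `g⁻¹ = J⁻¹ (J⁻¹)ᵀ`. This form makes upper and lower bounds
immediate from those for `J` and `J⁻¹`. -/
lemma conormalSq_eq (y : Vec n) : conormalSq x y = vsq (((jac x y)⁻¹)ᵀ *ᵥ y) := by
  have h1 : (metric x y)⁻¹ = (jac x y)⁻¹ * ((jac x y)⁻¹)ᵀ := by
    rw [metric, Matrix.mul_inv_rev, Matrix.transpose_nonsing_inv]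
  have h2 : conormalSq x y = (y : Fin n → ℝ) ⬝ᵥ ((metric x y)⁻¹ *ᵥ y) := by
    simp only [conormalSq, dotProduct, Matrix.mulVec, Finset.mul_sum]
    exact Finset.sum_congr rfl fun a _ => Finset.sum_congr rfl fun b _ => by ring
  have h3 : vsq (((jac x y)⁻¹)ᵀ *ᵥ y) =
      (((jac x y)⁻¹)ᵀ *ᵥ y) ⬝ᵥ (((jac x y)⁻¹)ᵀ *ᵥ y) := by
    simp only [vsq, dotProduct, sq]
  rw [h2, h1, h3, ← Matrix.mulVec_mulVec, Matrix.dotProduct_mulVec, ← Matrix.mulVec_transpose]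

lemma CoordinateCondition.conormalSq_le (hc : CoordinateCondition x c₁) {y : Vec n}
    (hy : y ∈ bdry n) : conormalSq x y ≤ c₁ ^ 2 + 1 := by
  rw [conormalSq_eq]
  refine (vsq_mulVec _ _).trans ?_
  rw [msq_transpose]
  exact (mul_le_of_le_one_right (msq_nonneg _) (vsq_le_one (bdry_subset_omBar hy))).trans
    (hc.msq_jac_inv_le (bdry_subset_omBar hy))

lemma CoordinateCondition.one_le_mul_conormalSq (hc : CoordinateCondition x c₁) {y : Vec n}
    (hy : y ∈ bdry n) : 1 ≤ (c₁ ^ 2 + 1) * conormalSq x y := by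
  have hyb := bdry_subset_omBar hy
  have hu : IsUnit (jac x y).det := isUnit_iff_ne_zero.2 (hc y hyb).1
  have h1 : (jac x y)ᵀ *ᵥ (((jac x y)⁻¹)ᵀ *ᵥ y) = (y : Fin n → ℝ) := by
    rw [Matrix.mulVec_mulVec, ← Matrix.transpose_mul, Matrix.nonsing_inv_mul _ hu,
      Matrix.transpose_one, Matrix.one_mulVec]
  have h2 : vsq y = 1 := by
    have := sum_sq_eq_one hy
    simpa [vsq, sq] using this
  have h3 := vsq_mulVec (jac x y)ᵀ (((jac x y)⁻¹)ᵀ *ᵥ y)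
  rw [h1, h2, msq_transpose, ← conormalSq_eq] at h3
  refine h3.trans (mul_le_mul_of_nonneg_right (hc.msq_jac_le hyb) ?_)
  rw [conormalSq_eq]; exact vsq_nonneg _

lemma CoordinateCondition.conormalSq_pos (hc : CoordinateCondition x c₁) {y : Vec n}
    (hy : y ∈ bdry n) : 0 < conormalSq x y := by
  have h := hc.one_le_mul_conormalSq hy
  by_contra h0
  have := mul_nonpos_of_nonneg_of_nonpos (by positivity : 0 ≤ c₁ ^ 2 + 1) (not_lt.1 h0)
  linarith

/-- The gradient is radial on the sphere, so only `g^{ab} y_a y_b` enters. Normal and radial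
derivatives are therefore comparable, with constants depending on `c₁`. -/
lemma normalDeriv_eq {f : Vec n → ℝ} (hf : SmoothUpTo f) (h0 : ∀ y ∈ bdry n, f y = 0)
    {y : Vec n} (hy : y ∈ bdry n) :
    normalDeriv x f y = Real.sqrt (conormalSq x y) * rad f y := by
  have h1 : ∀ a, ((metric x y)⁻¹ *ᵥ conormal x y) a =
      (∑ b, (metric x y)⁻¹ a b * y b) / Real.sqrt (conormalSq x y) := by
    intro a
    simp only [Matrix.mulVec, dotProduct, conormal, Finset.sum_div, mul_div_assoc]
    rfl
  have h2 : normalDeriv x f y =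
      (∑ a, ∑ b, (metric x y)⁻¹ a b * y a * y b) / Real.sqrt (conormalSq x y) * rad f y := by
    unfold normalDeriv
    simp only [h1, pd_eq_of_eq_zero_on_bdry hf h0 hy, Finset.sum_div, Finset.sum_mul]
    exact Finset.sum_congr rfl fun a _ => Finset.sum_congr rfl fun b _ => by ring
  rw [h2]
  congr 1
  exact Real.div_sqrt

lemma CoordinateCondition.rad_sq_le (hc : CoordinateCondition x c₁) {f : Vec n → ℝ}
    (hf : SmoothUpTo f) (h0 : ∀ y ∈ bdry n, f y = 0) {y : Vec n} (hy : y ∈ bdry n) :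
    rad f y ^ 2 ≤ (c₁ ^ 2 + 1) * normalDeriv x f y ^ 2 := by
  rw [normalDeriv_eq hf h0 hy, mul_pow, Real.sq_sqrt (hc.conormalSq_pos hy).le, ← mul_assoc]
  exact le_mul_of_one_le_left (sq_nonneg _) (hc.one_le_mul_conormalSq hy)

lemma CoordinateCondition.normalDeriv_sq_le (hc : CoordinateCondition x c₁) {f : Vec n → ℝ}
    (hf : SmoothUpTo f) (h0 : ∀ y ∈ bdry n, f y = 0) {y : Vec n} (hy : y ∈ bdry n) :
    normalDeriv x f y ^ 2 ≤ (c₁ ^ 2 + 1) * rad f y ^ 2 := by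
  rw [normalDeriv_eq hf h0 hy, mul_pow, Real.sq_sqrt (hc.conormalSq_pos hy).le]
  exact mul_le_mul_of_nonneg_right (hc.conormalSq_le hy) (sq_nonneg _)

lemma supBdry_nonneg (f : Vec n → ℝ) : 0 ≤ supBdry f := Real.iSup_nonneg fun _ => abs_nonneg _

lemma CoordinateCondition.rad_sq_le_supBdry (hc : CoordinateCondition x c₁) {f : Vec n → ℝ}
    (hf : SmoothUpTo f) (h0 : ∀ y ∈ bdry n, f y = 0) {y : Vec n} (hy : y ∈ bdry n) :
    rad f y ^ 2 ≤ (c₁ ^ 2 + 1) * supBdry (normalDeriv x f) ^ 2 := by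
  refine (hc.rad_sq_le hf h0 hy).trans (mul_le_mul_of_nonneg_left ?_ (by positivity))
  obtain ⟨C, hC0, hC⟩ := exists_abs_le_of_continuousOn hf.rad.continuousOn
  -- Needed again because an unbounded real supremum is 0.
  have hbdd : BddAbove (Set.range fun z : bdry n => |normalDeriv x f (z : Vec n)|) := by
    refine ⟨(c₁ ^ 2 + 1) * C, ?_⟩
    rintro _ ⟨z, rfl⟩
    refine abs_le_of_sq_le_sq ((hc.normalDeriv_sq_le hf h0 z.2).trans ?_) (by positivity)
    have h1 := hC z (bdry_subset_omBar z.2)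
    have h2 : rad f z ^ 2 ≤ C ^ 2 := sq_le_sq' (abs_le.1 h1).1 (abs_le.1 h1).2
    have h3 : c₁ ^ 2 + 1 ≤ (c₁ ^ 2 + 1) ^ 2 := by nlinarith [sq_nonneg c₁, sq_nonneg (c₁ ^ 2)]
    rw [mul_pow]
    exact mul_le_mul h3 h2 (sq_nonneg _) (by positivity)
  have h := le_ciSup hbdd ⟨y, hy⟩
  exact sq_le_sq' (by linarith [(abs_le.1 h).1, supBdry_nonneg (normalDeriv x f),
    (show |normalDeriv x f y| ≤ supBdry (normalDeriv x f) from h), neg_abs_le (normalDeriv x f y)])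
    ((le_abs_self _).trans h)

/-! ### Rotations -/

lemma along_rotation (f : Vec n → ℝ) (a b : Fin n) :
    along (rotation a b) f = fun y => y a * pd f b y - y b * pd f a y := by
  ext y
  simp [along, rotation, sub_mul, Finset.sum_sub_distrib]

/-- Rotations commute with dilations, whose generator is `y^a ∂_a`. -/
lemma rad_rotation {f : Vec n → ℝ} (hf : SmoothUpTo f) (a b : Fin n) {y : Vec n}
    (hy : y ∈ OmBar n) :
    rad (along (rotation a b) f) y = along (rotation a b) (rad f) y := by
  rw [along_rotation, along_rotation]
  simp only [pd_rad hf _ hy]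
  unfold rad
  have h : ∀ c, pd (fun y => y a * pd f b y - y b * pd f a y) c y =
      ((if c = a then 1 else 0) * pd f b y + y a * pd (pd f c) b y) -
      ((if c = b then 1 else 0) * pd f a y + y b * pd (pd f c) a y) := by
    intro c
    rw [pd_sub ((smoothUpTo_coord a).mul (hf.pd b)) ((smoothUpTo_coord b).mul (hf.pd a)) c hy,
      pd_mul (smoothUpTo_coord a) (hf.pd b) c hy, pd_mul (smoothUpTo_coord b) (hf.pd a) c hy,
      pd_coord c a hy, pd_coord c b hy, pd_comm hf b c hy, pd_comm hf a c hy]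
  simp only [h, mul_sub, mul_add, Finset.sum_sub_distrib, Finset.sum_add_distrib, Finset.mul_sum]
  simp
  rw [Finset.sum_congr rfl fun c _ => mul_left_comm (y c) (y a) _,
    Finset.sum_congr rfl fun c _ => mul_left_comm (y c) (y b) _]

lemma along_rotation_eq_zero {f : Vec n → ℝ} (hf : SmoothUpTo f) (h0 : ∀ y ∈ bdry n, f y = 0)
    (a b : Fin n) {y : Vec n} (hy : y ∈ bdry n) : along (rotation a b) f y = 0 := by
  rw [along_rotation]
  simp only [pd_eq_of_eq_zero_on_bdry hf h0 hy]
  ring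

lemma smoothUpTo_along_rotation {f : Vec n → ℝ} (hf : SmoothUpTo f) (a b : Fin n) :
    SmoothUpTo (along (rotation a b) f) := by
  rw [along_rotation]
  exact ((smoothUpTo_coord a).mul (hf.pd b)).sub ((smoothUpTo_coord b).mul (hf.pd a))

lemma supBdry_rotation_le {p : Vec n → ℝ} {S₁ : Finset (Vec n → Vec n)} {K₃ : ℝ}
    (hK₃ : ∑ S ∈ tangential S₁, supBdry (normalDeriv x (along S p)) ≤ K₃) {a b : Fin n}
    (hab : a < b) : supBdry (normalDeriv x (along (rotation a b) p)) ≤ K₃ := by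
  classical
  refine le_trans ?_ hK₃
  refine Finset.single_le_sum (f := fun S => supBdry (normalDeriv x (along S p)))
    (fun S _ => supBdry_nonneg _) ?_
  unfold tangential
  refine Finset.mem_union_left _ (Finset.mem_image.2 ⟨(a, b), ?_, rfl⟩)
  simpa using hab

/-- The tangential derivative of `rad p` is the radial derivative of the rotated `p`. The latter
also vanishes on the sphere, so the comparison with `∇_N` applies to it. Only pairs `a < b` occur in
`tangential`; the others follow by antisymmetry. -/
lemma CoordinateCondition.along_rotation_rad_sq_le (hc : CoordinateCondition x c₁)
    {p : Vec n → ℝ} (hp : SmoothUpTo p) (h0 : ∀ y ∈ bdry n, p y = 0)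
    {S₁ : Finset (Vec n → Vec n)} {K₃ : ℝ}
    (hK₃ : ∑ S ∈ tangential S₁, supBdry (normalDeriv x (along S p)) ≤ K₃) (a b : Fin n)
    {y : Vec n} (hy : y ∈ bdry n) :
    along (rotation a b) (rad p) y ^ 2 ≤ (c₁ ^ 2 + 1) * K₃ ^ 2 := by
  have key : ∀ a b : Fin n, a < b →
      along (rotation a b) (rad p) y ^ 2 ≤ (c₁ ^ 2 + 1) * K₃ ^ 2 := by
    intro a b hab
    rw [← rad_rotation hp a b (bdry_subset_omBar hy)]
    refine (hc.rad_sq_le_supBdry (smoothUpTo_along_rotation hp a b)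
      (fun z hz => along_rotation_eq_zero hp h0 a b hz) hy).trans ?_
    have h1 := supBdry_rotation_le hK₃ hab
    have h2 := supBdry_nonneg (normalDeriv x (along (rotation a b) p))
    gcongr
  rcases lt_trichotomy a b with h | h | h
  · exact key a b h
  · subst h
    have : along (rotation a a) (rad p) y = 0 := by rw [along_rotation]; ring
    rw [this, zero_pow two_ne_zero]; positivity
  · have : along (rotation a b) (rad p) y = - along (rotation b a) (rad p) y := by
      rw [along_rotation, along_rotation]; ring
    rw [this, neg_sq]; exact key b a h

end normal

/-! ### The multipliers -/

/-- A cutoff function that vanishes near the origin. -/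
noncomputable def collar (y : Vec n) : ℝ := Real.smoothTransition (4 * ‖y‖ ^ 2 - 1)

lemma contDiff_collar : ContDiff ℝ ∞ (collar (n := n)) := by
  apply contDiff_smoothTransition.comp
  have : ContDiff ℝ ∞ (fun y : Vec n => ‖y‖ ^ 2) := contDiff_norm_sq ℝ
  fun_prop

lemma collar_nonneg (y : Vec n) : 0 ≤ collar y := Real.smoothTransition.nonneg _

lemma collar_le_one (y : Vec n) : collar y ≤ 1 := Real.smoothTransition.le_one _

lemma collar_of_mem_bdry {y : Vec n} (hy : y ∈ bdry n) : collar y = 1 := by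
  have h : ‖y‖ = 1 := by simpa using hy
  rw [collar, h]; exact Real.smoothTransition.one_of_one_le (by norm_num)

lemma collar_eq_zero {y : Vec n} (hy : ‖y‖ ≤ 1 / 2) : collar y = 0 :=
  Real.smoothTransition.zero_of_nonpos (by nlinarith [norm_nonneg y])

lemma pd_collar {y : Vec n} (hy : y ∈ OmBar n) (a : Fin n) :
    pd collar a y = 8 * deriv Real.smoothTransition (4 * ‖y‖ ^ 2 - 1) * y a := by
  have h1 : HasFDerivAt (fun y : Vec n => (4 : ℝ) * ‖y‖ ^ 2 - 1)
      ((4 : ℝ) • ((2 : ℝ) • innerSL ℝ y)) y := by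
    have := (hasStrictFDerivAt_norm_sq y).hasFDerivAt
    have e : (2 : ℝ) • innerSL ℝ y = 2 • innerSL ℝ y := by rw [two_smul, two_nsmul]
    rw [e]
    exact (this.const_mul (4 : ℝ)).sub_const 1
  have h2 : HasDerivAt Real.smoothTransition (deriv Real.smoothTransition
      (4 * ‖y‖ ^ 2 - 1)) (4 * ‖y‖ ^ 2 - 1) :=
    (contDiff_smoothTransition.differentiable (by simp) _).hasDerivAt
  have h3 : HasFDerivAt collar _ y := h2.comp_hasFDerivAt y h1
  rw [pd_eq_fderiv a hy h3.differentiableAt, h3.fderiv]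
  simp [EuclideanSpace.inner_single_right]
  ring

lemma vsq_pd_collar_le {M : ℝ} (hM : ∀ t, |deriv Real.smoothTransition t| ≤ M) {y : Vec n}
    (hy : y ∈ OmBar n) : vsq (fun a => pd collar a y) ≤ 64 * M ^ 2 := by
  have h : vsq (fun a => pd collar a y) =
      64 * deriv Real.smoothTransition (4 * ‖y‖ ^ 2 - 1) ^ 2 * vsq y := by
    simp only [vsq, pd_collar hy, Finset.mul_sum]
    exact Finset.sum_congr rfl fun a _ => by ring
  have h1 := sq_le_sq' (abs_le.1 (hM (4 * ‖y‖ ^ 2 - 1))).1 (abs_le.1 (hM (4 * ‖y‖ ^ 2 - 1))).2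
  rw [h]
  exact (mul_le_of_le_one_right (by positivity) (vsq_le_one hy)).trans (by gcongr)

/-- The extension of the boundary values of `h` that is constant along rays, cut off near the
origin. -/
noncomputable def radialExt (h : Vec n → ℝ) (y : Vec n) : ℝ := collar y * h (unitVec y)

lemma radialExt_eventuallyEq_zero {h : Vec n → ℝ} {y : Vec n} (hy : ‖y‖ < 1 / 2) :
    radialExt h =ᶠ[nhds y] fun _ => 0 := by
  filter_upwards [(isOpen_lt continuous_norm continuous_const).mem_nhds hy] with z hz
  rw [radialExt, collar_eq_zero (le_of_lt hz), zero_mul]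

lemma SmoothUpTo.radialExt {h : Vec n → ℝ} (hh : SmoothUpTo h) : SmoothUpTo (radialExt h) := by
  intro y _
  by_cases hy : ‖y‖ < 1 / 2
  · exact (contDiffAt_const.congr_of_eventuallyEq
      (radialExt_eventuallyEq_zero hy)).contDiffWithinAt
  · have hy0 : y ≠ 0 := by rintro rfl; simp at hy
    exact (contDiff_collar.contDiffAt.mul (hh.comp_unitVec hy0)).contDiffWithinAt

lemma radialExt_of_mem_bdry {h : Vec n → ℝ} {y : Vec n} (hy : y ∈ bdry n) :
    radialExt h y = h y := by
  rw [radialExt, collar_of_mem_bdry hy, unitVec_of_mem_bdry hy, one_mul]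

/-- On the unit sphere `∂_a h - y_a (y · ∂h)` is the sum over `b` of `y_b` times the derivative of
`h` along the rotation of `b` and `a`. -/
lemma vsq_tangential_le {h : Vec n → ℝ} {R : ℝ} {y : Vec n} (hy : y ∈ bdry n)
    (hR : ∀ a b : Fin n, along (rotation a b) h y ^ 2 ≤ R) :
    vsq (fun a => pd h a y - y a * rad h y) ≤ n * (n * R) := by
  have h1 := sum_sq_eq_one hy
  have h2 : ∀ a, pd h a y - y a * rad h y = ∑ b, y b * along (rotation b a) h y := by
    intro a
    have : pd h a y = (∑ b, y b * y b) * pd h a y := by rw [h1, one_mul]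
    rw [this, rad, Finset.sum_mul, Finset.mul_sum, ← Finset.sum_sub_distrib]
    refine Finset.sum_congr rfl fun b _ => ?_
    rw [along_rotation]; ring
  have h3 : ∀ a ∈ Finset.univ, (pd h a y - y a * rad h y) ^ 2 ≤ n * R := by
    intro a _
    rw [h2]
    refine (dotProduct_sq_le _ _).trans ?_
    have h4 : vsq y = 1 := by simpa [vsq, sq] using h1
    rw [h4, one_mul]
    have := Finset.sum_le_card_nsmul Finset.univ (fun b => along (rotation b a) h y ^ 2) R
      (fun b _ => hR b a)
    simpa [vsq] using this
  have := Finset.sum_le_card_nsmul Finset.univ _ _ h3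
  simpa [vsq] using this

/-- The extension has no radial derivative apart from that of the collar, so no bound for the normal
derivative of `h` is required. For `h = rad p` that would be a second normal derivative of `p`,
which the given constants do not control. -/
lemma vsq_pd_radialExt_le {h : Vec n → ℝ} (hh : SmoothUpTo h) {M B R : ℝ}
    (hM : ∀ t, |deriv Real.smoothTransition t| ≤ M) (hB0 : 0 ≤ B) (hR0 : 0 ≤ R)
    (hB : ∀ y ∈ bdry n, h y ^ 2 ≤ B)
    (hR : ∀ y ∈ bdry n, ∀ a b : Fin n, along (rotation a b) h y ^ 2 ≤ R) {y : Vec n}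
    (hy : y ∈ OmBar n) :
    vsq (fun a => pd (radialExt h) a y) ≤ 128 * M ^ 2 * B + 8 * n ^ 2 * R := by
  by_cases hy1 : ‖y‖ < 1 / 2
  · have h1 : ∀ a, pd (radialExt h) a y = 0 := by
      intro a
      have he := radialExt_eventuallyEq_zero (h := h) hy1
      rw [pd_eq_fderiv a hy (differentiableAt_const (0 : ℝ) |>.congr_of_eventuallyEq he),
        he.fderiv_eq]
      simp
    simp only [h1, vsq]
    simp
    positivity
  · have hy0 : y ≠ 0 := by rintro rfl; simp at hy1
    have hu := unitVec_mem_bdry hy0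
    set u := unitVec y
    set T : Fin n → ℝ := fun a => pd h a u - u a * rad h u
    have h1 : (fun a => pd (radialExt h) a y) =
        (h u • fun a => pd collar a y) + (collar y * ‖y‖⁻¹) • T := by
      ext a
      have hd1 := (contDiff_collar (n := n)).differentiable (by simp) y
      have hd2 := (hh.comp_unitVec hy0).differentiableAt (by simp)
      have hd : DifferentiableAt ℝ (radialExt h) y := hd1.mul hd2
      have e := pd_comp_unitVec hh hy0 hy a
      rw [pd_eq_fderiv a hy hd2] at e
      rw [pd_eq_fderiv a hy hd]
      have e2 : fderiv ℝ (radialExt h) y = _ := fderiv_fun_mul hd1 hd2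
      rw [e2, Pi.add_apply, Pi.smul_apply, Pi.smul_apply, pd_eq_fderiv a hy hd1]
      rw [add_apply, smul_apply, smul_apply, e]
      simp only [smul_eq_mul, T]
      ring
    have hs : ∀ (c : ℝ) (v : Fin n → ℝ), vsq (c • v) = c ^ 2 * vsq v := by
      intro c v
      simp only [vsq, Pi.smul_apply, smul_eq_mul, mul_pow, Finset.mul_sum]
    rw [h1]
    refine (vsq_add_le _ _).trans ?_
    rw [hs, hs]
    have t1 : h u ^ 2 * vsq (fun a => pd collar a y) ≤ B * (64 * M ^ 2) :=
      mul_le_mul (hB u hu) (vsq_pd_collar_le hM hy) (vsq_nonneg _) hB0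
    have t2 : (collar y * ‖y‖⁻¹) ^ 2 ≤ 4 := by
      -- The factor `‖y‖⁻¹` from the radial projection is harmless because `‖y‖ ≥ 1 / 2` in this
      -- case.
      have a1 : collar y * ‖y‖⁻¹ ≤ 1 * 2 := by
        refine mul_le_mul (collar_le_one y) ?_ (inv_nonneg.2 (norm_nonneg _)) zero_le_one
        rw [inv_le_comm₀ (norm_pos_iff.2 hy0) two_pos]
        linarith [not_lt.1 hy1]
      have a2 : 0 ≤ collar y * ‖y‖⁻¹ :=
        mul_nonneg (collar_nonneg y) (inv_nonneg.2 (norm_nonneg _))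
      nlinarith
    have t3 : (collar y * ‖y‖⁻¹) ^ 2 * vsq T ≤ 4 * (n * (n * R)) :=
      mul_le_mul t2 (vsq_tangential_le hu (hR u hu)) (vsq_nonneg _) (by norm_num)
    linarith

/-! ### The estimate with an arbitrary function of the given boundary values -/

lemma smoothUpTo_along {W : Vec n → Vec n} (hW : SmoothUpTo W) {p : Vec n → ℝ}
    (hp : SmoothUpTo p) : SmoothUpTo (along W p) :=
  SmoothUpTo.sum fun a => (hW.comp_coord a).mul (hp.pd a)

/-- The gradient of any function with the boundary values of `(∂_c p) W^c` controls the
derivatives of `W`, up to curl, divergence and terms of order zero. -/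
theorem exists_integral_partials_le (n : ℕ) (c₁ : ℝ) :
    ∃ C : ℝ, 0 < C ∧ ∀ (x : Vec n → Vec n) (p : Vec n → ℝ) (W : Vec n → Vec n)
      (S₁ : Finset (Vec n → Vec n)) (c₀ K₂ K₃ : ℝ) (ψ : Vec n → ℝ),
      SmoothUpTo x → CoordinateCondition x c₁ → SmoothUpTo p → (∀ y ∈ bdry n, p y = 0) →
      SmoothUpTo W → 0 < c₀ → (∀ y ∈ bdry n, c₀ ≤ |normalDeriv x p y|) →
      supBdry (normalDeriv x p) ≤ K₂ →
      ∑ S ∈ tangential S₁, supBdry (normalDeriv x (along S p)) ≤ K₃ →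
      SmoothUpTo ψ → (∀ y ∈ bdry n, ψ y = 0) →
      c₀ ^ 2 * ∫ y in Om n, msq (partials W y) ≤
        C * ((∫ y in Om n, vsq (fun a => pd (fun z => along W p z + ψ z) a y)) +
          K₂ ^ 2 * ((∫ y in Om n, msq (curl (lower x W) y)) +
            ∫ y in Om n, divergence x W y ^ 2) +
          (K₃ ^ 2 + K₂ ^ 2 * metricBracket x ^ 2) * ∫ y in Om n, vsq (W y)) := by
  obtain ⟨M, hM0, hM⟩ := exists_bound_deriv_smoothTransition
  set k := c₁ ^ 2 + 1 with hk
  have hk1 : 1 ≤ k := by rw [hk]; nlinarith [sq_nonneg c₁]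
  have hN := multConst_pos n c₁
  set N := multConst n c₁
  refine ⟨2 * k * N * (1 + (k + k ^ 2) + 128 * M ^ 2 * k + 8 * n ^ 2 * k + 64 * M ^ 2 * k ^ 2),
    by positivity, ?_⟩
  intro x p W S₁ c₀ K₂ K₃ ψ hx hc hp hp0 hW hc₀ hc₀' hK₂ hK₃ hψ hψ0
  have hIF : 0 ≤ ∫ y in Om n, vsq (fun a => pd (fun z => along W p z + ψ z) a y) :=
    integral_nonneg fun _ => vsq_nonneg _
  have hQ1 : 0 ≤ ∫ y in Om n, msq (curl (lower x W) y) := integral_nonneg fun _ => msq_nonneg _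
  have hQ2 : 0 ≤ ∫ y in Om n, divergence x W y ^ 2 := integral_nonneg fun _ => sq_nonneg _
  have hw : 0 ≤ ∫ y in Om n, vsq (W y) := integral_nonneg fun _ => vsq_nonneg _
  have hK20 : 0 ≤ K₂ := (supBdry_nonneg _).trans hK₂
  -- In dimension zero the sphere is empty and `c₀` is not tied to `K₂`, but there are no
  -- derivatives.
  rcases Nat.eq_zero_or_pos n with hn | hn
  · subst hn
    have : ∀ y, msq (partials W y) = 0 := fun y => by simp [msq]
    simp only [this, integral_zero, mul_zero]
    positivity
  set h := rad p with hh
  have sh : SmoothUpTo h := hp.rad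
  have hhB : ∀ y ∈ bdry n, h y ^ 2 ≤ k * K₂ ^ 2 := fun y hy =>
    (hc.rad_sq_le_supBdry hp hp0 hy).trans (by
      have := supBdry_nonneg (normalDeriv x p)
      gcongr)
  have hhl : ∀ y ∈ bdry n, c₀ ^ 2 ≤ k * h y ^ 2 := fun y hy => by
    refine le_trans ?_ (hc.normalDeriv_sq_le hp hp0 hy)
    rw [← sq_abs (normalDeriv x p y)]
    have := hc₀' y hy
    gcongr
  -- Evaluated at one boundary point; this converts the `c₀` terms of the interior estimate into
  -- `K₂` terms.
  have hc2 : c₀ ^ 2 ≤ k ^ 2 * K₂ ^ 2 := by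
    have hy : EuclideanSpace.single (⟨0, hn⟩ : Fin n) (1 : ℝ) ∈ bdry n := by simp
    have h1 := hhl _ hy
    have h2 := mul_le_mul_of_nonneg_left (hhB _ hy) (by linarith : 0 ≤ k)
    linarith
  have hR : ∀ y ∈ bdry n, ∀ a b : Fin n, along (rotation a b) h y ^ 2 ≤ k * K₃ ^ 2 :=
    fun y hy a b => hc.along_rotation_rad_sq_le hp hp0 hK₃ a b hy
  -- Boundary multiplier: on the sphere `radialExt h` equals `y · ∂p`, so `φ (y · W)` is exactly
  -- `(∂_c p) W^c`.
  have est1 := integral_multiplier_le hx hc hW (φ := radialExt h)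
    (f := fun z => along W p z + ψ z) (B := k * K₂ ^ 2)
    (Λ := 128 * M ^ 2 * (k * K₂ ^ 2) + 8 * n ^ 2 * (k * K₃ ^ 2)) sh.radialExt
    ((smoothUpTo_along hW hp).add hψ)
    (fun y hy => by
      by_cases hy0 : ‖y‖ < 1 / 2
      · rw [radialExt, collar_eq_zero hy0.le]; simp; positivity
      · have hy0 : y ≠ 0 := by rintro rfl; simp at hy0
        rw [radialExt, mul_pow]
        refine (mul_le_of_le_one_left (sq_nonneg _) ?_).trans (hhB _ (unitVec_mem_bdry hy0))
        nlinarith [collar_nonneg y, collar_le_one y])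
    (fun y hy => vsq_pd_radialExt_le sh hM (by positivity) (by positivity) hhB hR hy)
    (fun y hy => by
      rw [radialExt_of_mem_bdry hy, hψ0 y hy, add_zero, along, Finset.mul_sum]
      refine Finset.sum_congr rfl fun a _ => ?_
      rw [pd_eq_of_eq_zero_on_bdry hp hp0 hy]; ring)
  have sφ : SmoothUpTo (fun y : Vec n => c₀ * (1 - collar y)) :=
    (smoothUpTo_const c₀).mul ((smoothUpTo_const 1).sub (smoothUpTo_of_contDiff contDiff_collar))
  -- Interior multiplier: it vanishes on the sphere, so `f = 0` has the required boundary values.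
  have est2 := integral_multiplier_le hx hc hW (φ := fun y => c₀ * (1 - collar y))
    (f := fun _ => 0) (B := c₀ ^ 2) (Λ := c₀ ^ 2 * (64 * M ^ 2)) sφ
    (smoothUpTo_const 0)
    (fun y hy => by
      rw [mul_pow]
      refine mul_le_of_le_one_right (sq_nonneg _) ?_
      nlinarith [collar_nonneg y, collar_le_one y])
    (fun y hy => by
      have e : ∀ a, pd (fun y : Vec n => c₀ * (1 - collar y)) a y = - c₀ * pd collar a y := by
        intro a
        have sc : SmoothUpTo (collar (n := n)) := smoothUpTo_of_contDiff contDiff_collar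
        rw [pd_mul (smoothUpTo_const c₀) ((smoothUpTo_const 1).sub sc) a hy,
          pd_sub (smoothUpTo_const 1) sc a hy, pd_const, pd_const]
        ring
      have e2 : vsq (fun a => pd (fun y : Vec n => c₀ * (1 - collar y)) a y) =
          c₀ ^ 2 * vsq (fun a => pd collar a y) := by
        simp only [vsq, e, Finset.mul_sum]
        exact Finset.sum_congr rfl fun a _ => by ring
      rw [e2]
      exact mul_le_mul_of_nonneg_left (vsq_pd_collar_le hM hy) (sq_nonneg _))
    (fun y hy => by rw [collar_of_mem_bdry hy]; ring)
  have z2 : ∫ y in Om n, vsq (fun a => pd (fun _ : Vec n => (0 : ℝ)) a y) = 0 := by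
    simp [vsq]
  rw [z2, zero_add] at est2
  -- The two squared multipliers add up to at least `c₀² (χ² + (1 - χ)²) / k`, and `χ² + (1 - χ)² ≥
  -- 1 / 2`.
  have low : c₀ ^ 2 / (2 * k) * ∫ y in Om n, msq (partials W y) ≤
      (∫ y in Om n, radialExt h y ^ 2 * msq (partials W y)) +
        ∫ y in Om n, (c₀ * (1 - collar y)) ^ 2 * msq (partials W y) := by
    have i0 : IntegrableOn (fun y => msq (partials W y)) (Om n) :=
      integrableOn_of_continuousOn (continuousOn_msq_partials hW)
    have i1 : IntegrableOn (fun y => radialExt h y ^ 2 * msq (partials W y)) (Om n) :=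
      integrableOn_of_continuousOn
        ((sh.radialExt.continuousOn.pow 2).mul (continuousOn_msq_partials hW))
    have i2 : IntegrableOn (fun y => (c₀ * (1 - collar y)) ^ 2 * msq (partials W y)) (Om n) :=
      integrableOn_of_continuousOn
        ((sφ.continuousOn.pow 2).mul (continuousOn_msq_partials hW))
    rw [← integral_const_mul, ← integral_add i1 i2]
    refine setIntegral_mono_on (i0.const_mul _) (i1.add i2) measurableSet_ball fun y hy => ?_
    rw [← add_mul]
    refine mul_le_mul_of_nonneg_right ?_ (msq_nonneg _)
    rw [div_le_iff₀ (by positivity)]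
    have hcn := collar_nonneg y
    set χ := collar y with hχ
    have hr : radialExt h y ^ 2 * k ≥ χ ^ 2 * c₀ ^ 2 := by
      by_cases hy0 : y = 0
      · have : χ = 0 := collar_eq_zero (by rw [hy0]; simp)
        rw [this, zero_pow two_ne_zero, zero_mul]; positivity
      · rw [radialExt, mul_pow, mul_assoc, mul_comm (h _ ^ 2)]
        exact mul_le_mul_of_nonneg_left (hhl _ (unitVec_mem_bdry hy0)) (sq_nonneg _)
    have hc' : (c₀ * (1 - χ)) ^ 2 * k ≥ (1 - χ) ^ 2 * c₀ ^ 2 := by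
      rw [mul_pow, mul_comm (c₀ ^ 2)]
      exact le_mul_of_one_le_right (by positivity) hk1
    have hs : 0 ≤ (2 * χ - 1) ^ 2 * c₀ ^ 2 := by positivity
    linarith
  set I := ∫ y in Om n, vsq (fun a => pd (fun z => along W p z + ψ z) a y)
  set Q := (∫ y in Om n, msq (curl (lower x W) y)) + ∫ y in Om n, divergence x W y ^ 2 with hQ
  have hQ0 : 0 ≤ Q := add_nonneg hQ1 hQ2
  set w := ∫ y in Om n, vsq (W y)
  set G := metricBracket x
  have hG : 1 ≤ G ^ 2 := by nlinarith [one_le_metricBracket (x := x)]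
  set L := ∫ y in Om n, msq (partials W y)
  have total : c₀ ^ 2 / (2 * k) * L ≤ N * (I + (k * K₂ ^ 2 + c₀ ^ 2) * Q +
      (128 * M ^ 2 * (k * K₂ ^ 2) + 8 * n ^ 2 * (k * K₃ ^ 2) + c₀ ^ 2 * (64 * M ^ 2) +
        (k * K₂ ^ 2 + c₀ ^ 2) * G ^ 2) * w) := by
    refine low.trans ((add_le_add est1 est2).trans (le_of_eq (by ring)))
  have total2 : c₀ ^ 2 * L ≤ 2 * k * (N * (I + (k * K₂ ^ 2 + c₀ ^ 2) * Q +
      (128 * M ^ 2 * (k * K₂ ^ 2) + 8 * n ^ 2 * (k * K₃ ^ 2) + c₀ ^ 2 * (64 * M ^ 2) +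
        (k * K₂ ^ 2 + c₀ ^ 2) * G ^ 2) * w)) := by
    rw [div_mul_eq_mul_div, div_le_iff₀ (by positivity)] at total
    linarith
  refine total2.trans ?_
  rw [← mul_assoc, mul_assoc (2 * k * N)]
  refine mul_le_mul_of_nonneg_left ?_ (by positivity)
  set X := K₂ ^ 2 * G ^ 2 with hX
  have hX0 : 0 ≤ X := by positivity
  have hXK : K₂ ^ 2 ≤ X := le_mul_of_one_le_right (sq_nonneg _) hG
  calc I + (k * K₂ ^ 2 + c₀ ^ 2) * Q +
      (128 * M ^ 2 * (k * K₂ ^ 2) + 8 * n ^ 2 * (k * K₃ ^ 2) + c₀ ^ 2 * (64 * M ^ 2) +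
        (k * K₂ ^ 2 + c₀ ^ 2) * G ^ 2) * w
      ≤ I + (k * K₂ ^ 2 + k ^ 2 * K₂ ^ 2) * Q +
      (128 * M ^ 2 * (k * K₂ ^ 2) + 8 * n ^ 2 * (k * K₃ ^ 2) + (k ^ 2 * K₂ ^ 2) * (64 * M ^ 2) +
        (k * K₂ ^ 2 + k ^ 2 * K₂ ^ 2) * G ^ 2) * w := by gcongr
    _ = I + (k + k ^ 2) * (K₂ ^ 2 * Q) +
      ((128 * M ^ 2 * k + 64 * M ^ 2 * k ^ 2) * K₂ ^ 2 + (8 * n ^ 2 * k) * K₃ ^ 2 +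
        (k + k ^ 2) * X) * w := by rw [hX]; ring
    _ ≤ I + (k + k ^ 2) * (K₂ ^ 2 * Q) +
      ((128 * M ^ 2 * k + 64 * M ^ 2 * k ^ 2) * X + (8 * n ^ 2 * k) * K₃ ^ 2 +
        (k + k ^ 2) * X) * w := by gcongr
    _ = I + (k + k ^ 2) * (K₂ ^ 2 * Q) +
      (128 * M ^ 2 * k + 64 * M ^ 2 * k ^ 2 + (k + k ^ 2)) * (X * w) +
      (8 * n ^ 2 * k) * (K₃ ^ 2 * w) := by ring
    _ ≤ (1 + (k + k ^ 2) + 128 * M ^ 2 * k + 8 * n ^ 2 * k + 64 * M ^ 2 * k ^ 2) * I +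
        (1 + (k + k ^ 2) + 128 * M ^ 2 * k + 8 * n ^ 2 * k + 64 * M ^ 2 * k ^ 2) * (K₂ ^ 2 * Q) +
        (1 + (k + k ^ 2) + 128 * M ^ 2 * k + 8 * n ^ 2 * k + 64 * M ^ 2 * k ^ 2) * (X * w) +
        (1 + (k + k ^ 2) + 128 * M ^ 2 * k + 8 * n ^ 2 * k + 64 * M ^ 2 * k ^ 2) *
          (K₃ ^ 2 * w) := by
      have b1 : 0 ≤ k + k ^ 2 := by positivity
      have b2 : 0 ≤ 128 * M ^ 2 * k := by positivity
      have b3 : 0 ≤ 8 * (n : ℝ) ^ 2 * k := by positivity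
      have b4 : 0 ≤ 64 * M ^ 2 * k ^ 2 := by positivity
      have c1 : 0 ≤ K₂ ^ 2 * Q := by positivity
      have c2 : 0 ≤ X * w := by positivity
      have c3 : 0 ≤ K₃ ^ 2 * w := by positivity
      refine add_le_add (add_le_add (add_le_add ?_ ?_) ?_) ?_
      · exact le_mul_of_one_le_left hIF (by linarith)
      · exact mul_le_mul_of_nonneg_right (by linarith) c1
      · exact mul_le_mul_of_nonneg_right (by linarith) c2
      · exact mul_le_mul_of_nonneg_right (by linarith) c3
    _ = _ := by ring

/-! ### The projection onto divergence free fields -/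

section projection

variable {x : Vec n → Vec n} {c₁ : ℝ}

lemma norm_sq_eq_vsq (v : Vec n) : ‖v‖ ^ 2 = vsq v := EuclideanSpace.real_norm_sq_eq v

lemma continuousOn_jac_inv (hx : SmoothUpTo x) (hc : CoordinateCondition x c₁) (a i : Fin n) :
    ContinuousOn (fun y => (jac x y)⁻¹ a i) (OmBar n) := by
  have hJ : Continuous fun y : OmBar n => jac x y :=
    continuous_matrix fun i a =>
      continuousOn_iff_continuous_domRestrict.1 (smoothUpTo_jac hx i a).continuousOn
  have h : Continuous fun y : OmBar n => (jac x y)⁻¹ a i := by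
    simp only [Matrix.inv_def, Ring.inverse_eq_inv', Matrix.smul_apply, smul_eq_mul]
    exact (hJ.matrix_det.inv₀ fun y => (hc y y.2).1).mul (hJ.matrix_adjugate.matrix_elem a i)
  exact continuousOn_iff_continuous_domRestrict.2 h

lemma toEuler_grad (hc : CoordinateCondition x c₁) (f : Vec n → ℝ) {y : Vec n}
    (hy : y ∈ OmBar n) :
    toEuler x (grad x f) y = WithLp.toLp 2 (((jac x y)⁻¹)ᵀ *ᵥ fun b => pd f b y) := by
  have hu : IsUnit (jac x y).det := isUnit_iff_ne_zero.2 (hc y hy).1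
  unfold toEuler grad
  congr 1
  change jac x y *ᵥ ((metric x y)⁻¹ *ᵥ fun b => pd f b y) = _
  rw [Matrix.mulVec_mulVec, metric, Matrix.mul_inv_rev, ← Matrix.mul_assoc,
    Matrix.mul_nonsing_inv _ hu, Matrix.one_mul, Matrix.transpose_nonsing_inv]

lemma toEuler_neg (U : Vec n → Vec n) (y : Vec n) :
    toEuler x (fun y => - U y) y = - toEuler x U y := by
  unfold toEuler
  rw [← WithLp.toLp_neg, ← Matrix.mulVec_neg]
  rfl

lemma continuousOn_toEuler_grad (hx : SmoothUpTo x) (hc : CoordinateCondition x c₁)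
    {f : Vec n → ℝ} (hf : SmoothUpTo f) : ContinuousOn (toEuler x (grad x f)) (OmBar n) := by
  refine ContinuousOn.congr (f := fun y =>
    WithLp.toLp 2 (((jac x y)⁻¹)ᵀ *ᵥ fun b => pd f b y)) ?_ fun y hy => toEuler_grad hc f hy
  refine (PiLp.continuous_toLp 2 _).comp_continuousOn (continuousOn_pi.2 fun i => ?_)
  simp only [Matrix.mulVec, dotProduct, Matrix.transpose_apply]
  exact continuousOn_finsetSum _ fun a _ =>
    (continuousOn_jac_inv hx hc a i).mul (hf.pd a).continuousOn

/-! ### The measure `κ dy` and gradient fields in the Hilbert space. -/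

lemma aemeasurable_kap (hx : SmoothUpTo x) (hc : CoordinateCondition x c₁) :
    AEMeasurable (fun y => ENNReal.ofReal (kap x y)) (volume.restrict (Om n)) :=
  (((smoothUpTo_kap hx hc).continuousOn.mono om_subset_omBar).aemeasurable
    measurableSet_ball).ennreal_ofReal

lemma ae_vol_mem_om (x : Vec n → Vec n) : ∀ᵐ y ∂(vol x), y ∈ Om n :=
  (withDensity_absolutelyContinuous _ _).ae_le (ae_restrict_mem measurableSet_ball)

/-- Positivity of `κ` lets almost everywhere statements about Hilbert space elements pass to `dy`,
in which the norms of the theorem are taken. -/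
lemma restrict_absolutelyContinuous_vol (hx : SmoothUpTo x) (hc : CoordinateCondition x c₁) :
    (volume.restrict (Om n)) ≪ vol x := by
  refine withDensity_absolutelyContinuous' (aemeasurable_kap hx hc) ?_
  filter_upwards [ae_restrict_mem measurableSet_ball] with y hy
  simpa using hc.kap_pos (om_subset_omBar hy)

lemma isFiniteMeasure_vol (hx : SmoothUpTo x) (hc : CoordinateCondition x c₁) :
    IsFiniteMeasure (vol x) :=
  isFiniteMeasure_withDensity_ofReal
    (integrableOn_of_continuousOn (smoothUpTo_kap hx hc).continuousOn).2

lemma integral_vol (hx : SmoothUpTo x) (hc : CoordinateCondition x c₁) (g : Vec n → ℝ) :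
    ∫ y, g y ∂(vol x) = ∫ y in Om n, kap x y * g y := by
  unfold vol
  rw [integral_withDensity_eq_integral_toReal_smul₀ (aemeasurable_kap hx hc)
    (Filter.Eventually.of_forall fun _ => ENNReal.ofReal_lt_top)]
  refine setIntegral_congr_fun measurableSet_ball fun y hy => ?_
  simp only [smul_eq_mul]
  rw [ENNReal.toReal_ofReal (hc.kap_pos (om_subset_omBar hy)).le]

lemma memLp_of_continuousOn (hx : SmoothUpTo x) (hc : CoordinateCondition x c₁)
    {u : Vec n → Vec n} (hu : ContinuousOn u (OmBar n)) : MemLp u 2 (vol x) := by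
  have := isFiniteMeasure_vol hx hc
  obtain ⟨C, hC⟩ := (isCompact_closedBall (0 : Vec n) 1).exists_bound_of_continuousOn hu
  refine MemLp.of_bound (((hu.mono om_subset_omBar).aestronglyMeasurable
    measurableSet_ball).mono_ac (withDensity_absolutelyContinuous _ _)) C ?_
  filter_upwards [ae_vol_mem_om x] with y hy using hC y (om_subset_omBar hy)

lemma memLp_toEuler_grad (hx : SmoothUpTo x) (hc : CoordinateCondition x c₁)
    {f : Vec n → ℝ} (hf : SmoothUpTo f) : MemLp (toEuler x (grad x f)) 2 (vol x) :=
  memLp_of_continuousOn hx hc (continuousOn_toEuler_grad hx hc hf)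

lemma coeFn_toField {U : Vec n → Vec n} (h : MemLp (toEuler x U) 2 (vol x)) :
    ⇑(toField x U) =ᵐ[vol x] toEuler x U := by
  rw [toField, dif_pos h]; exact h.coeFn_toLp

lemma coeFn_toField_grad (hx : SmoothUpTo x) (hc : CoordinateCondition x c₁)
    {f : Vec n → ℝ} (hf : SmoothUpTo f) :
    ∀ᵐ y ∂(vol x), y ∈ Om n ∧ toField x (grad x f) y =
      WithLp.toLp 2 (((jac x y)⁻¹)ᵀ *ᵥ fun b => pd f b y) := by
  filter_upwards [coeFn_toField (memLp_toEuler_grad hx hc hf), ae_vol_mem_om x] with y h hy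
  exact ⟨hy, h.trans (toEuler_grad hc f (om_subset_omBar hy))⟩

lemma toField_grad_add (hx : SmoothUpTo x) (hc : CoordinateCondition x c₁)
    {f g : Vec n → ℝ} (hf : SmoothUpTo f) (hg : SmoothUpTo g) :
    toField x (grad x fun y => f y + g y) = toField x (grad x f) + toField x (grad x g) := by
  apply Lp.ext
  filter_upwards [coeFn_toField_grad hx hc hf, coeFn_toField_grad hx hc hg,
    coeFn_toField_grad hx hc (hf.add hg), Lp.coeFn_add (toField x (grad x f))
      (toField x (grad x g))] with y h1 h2 h3 h4
  rw [h4, Pi.add_apply, h1.2, h2.2, h3.2, ← WithLp.toLp_add, ← Matrix.mulVec_add]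
  congr 2
  ext b
  exact pd_add hf hg b (om_subset_omBar h1.1)

lemma toField_grad_smul (hx : SmoothUpTo x) (hc : CoordinateCondition x c₁)
    {f : Vec n → ℝ} (hf : SmoothUpTo f) (r : ℝ) :
    toField x (grad x fun y => r * f y) = r • toField x (grad x f) := by
  apply Lp.ext
  filter_upwards [coeFn_toField_grad hx hc hf,
    coeFn_toField_grad hx hc ((smoothUpTo_const r).mul hf),
    Lp.coeFn_smul r (toField x (grad x f))] with y h1 h2 h3
  rw [h3, Pi.smul_apply, h1.2, h2.2, ← WithLp.toLp_smul, ← Matrix.mulVec_smul]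
  congr 2
  ext b
  rw [pd_mul (smoothUpTo_const r) hf b (om_subset_omBar h1.1)]
  simp

lemma toField_neg_grad (hx : SmoothUpTo x) (hc : CoordinateCondition x c₁)
    {f : Vec n → ℝ} (hf : SmoothUpTo f) :
    toField x (fun y => - grad x f y) = - toField x (grad x f) := by
  have hm : MemLp (toEuler x fun y => - grad x f y) 2 (vol x) := by
    refine (memLp_toEuler_grad hx hc hf).neg.congr_norm ?_ (Filter.Eventually.of_forall fun y => ?_)
    · have : (toEuler x fun y => - grad x f y) = - toEuler x (grad x f) :=
        funext fun y => toEuler_neg _ _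
      rw [this]; exact (memLp_toEuler_grad hx hc hf).1.neg
    · rw [toEuler_neg]; rfl
  apply Lp.ext
  filter_upwards [coeFn_toField hm, coeFn_toField (memLp_toEuler_grad hx hc hf),
    Lp.coeFn_neg (toField x (grad x f))] with y h1 h2 h3
  rw [h1, h3, Pi.neg_apply, h2, toEuler_neg]

lemma IsTest.smoothUpTo {φ : Vec n → ℝ} (h : IsTest φ) : SmoothUpTo φ := h.1.contDiffOn

lemma IsTest.eq_zero_of_mem_bdry {φ : Vec n → ℝ} (h : IsTest φ) {y : Vec n} (hy : y ∈ bdry n) :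
    φ y = 0 := by
  refine image_eq_zero_of_notMem_tsupport fun hmem => ?_
  have h1 : ‖y‖ < 1 := by simpa using h.2.2 hmem
  have h2 : ‖y‖ = 1 := by simpa using hy
  linarith

lemma isTest_zero : IsTest (fun _ : Vec n => (0 : ℝ)) := by
  have h : tsupport (fun _ : Vec n => (0 : ℝ)) = ∅ := by
    rw [tsupport_eq_empty_iff]; rfl
  exact ⟨contDiff_const, HasCompactSupport.zero, by rw [h]; exact Set.empty_subset _⟩

lemma IsTest.add {φ ψ : Vec n → ℝ} (h : IsTest φ) (h' : IsTest ψ) :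
    IsTest (fun y => φ y + ψ y) :=
  ⟨h.1.add h'.1, h.2.1.add h'.2.1, (tsupport_add φ ψ).trans (Set.union_subset h.2.2 h'.2.2)⟩

lemma IsTest.const_mul {φ : Vec n → ℝ} (h : IsTest φ) (r : ℝ) : IsTest (fun y => r * φ y) :=
  ⟨contDiff_const.mul h.1, h.2.1.mul_left (f := fun _ => r), (tsupport_mul_subset_right
    (f := fun _ => r) (g := φ)).trans h.2.2⟩

/-- Test functions form a linear space and the gradient is linear, so taking the span adds nothing.
-/
lemma exists_of_mem_gradientFields (hx : SmoothUpTo x) (hc : CoordinateCondition x c₁)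
    {F : FieldSpace x} (hF : F ∈ gradientFields x) :
    ∃ φ, IsTest φ ∧ F = toField x (grad x φ) := by
  unfold gradientFields at hF
  induction hF using Submodule.span_induction with
  | mem F h => exact h
  | zero =>
    refine ⟨_, isTest_zero, ?_⟩
    have h := toField_grad_smul hx hc (isTest_zero (n := n)).smoothUpTo 0
    simpa using h.symm
  | add F G _ _ h h' =>
    obtain ⟨φ, hφ, rfl⟩ := h
    obtain ⟨ψ, hψ, rfl⟩ := h'
    exact ⟨_, hφ.add hψ, (toField_grad_add hx hc hφ.smoothUpTo hψ.smoothUpTo).symm⟩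
  | smul r F _ h =>
    obtain ⟨φ, hφ, rfl⟩ := h
    exact ⟨_, hφ.const_mul r, (toField_grad_smul hx hc hφ.smoothUpTo r).symm⟩

/-- The projection is approximated by the gradients of functions with the same boundary values. -/
lemma exists_test_norm_le (hx : SmoothUpTo x) (hc : CoordinateCondition x c₁)
    {F : Vec n → ℝ} (hF : SmoothUpTo F) {ε : ℝ} (hε : 0 < ε) :
    ∃ ψ, IsTest ψ ∧ ‖toField x (grad x fun y => F y + ψ y)‖ ≤
      ‖proj x (toField x fun y => - grad x F y)‖ + ε := by
  set G := toField x fun y => - grad x F y with hG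
  -- The divergence free fields are defined as an orthogonal complement, and the double complement
  -- is the closure. This is the only trace of the Dirichlet problem for `q`.
  have h1 : G - proj x G ∈ (gradientFields x).topologicalClosure := by
    rw [← Submodule.orthogonal_orthogonal_eq_closure]
    exact (divFreeFields x).sub_starProjection_mem_orthogonal G
  have h2 : G - proj x G ∈ closure ((gradientFields x : Submodule ℝ (FieldSpace x)) :
      Set (FieldSpace x)) := h1
  obtain ⟨H, hH, hd⟩ := Metric.mem_closure_iff.1 h2 ε hε
  obtain ⟨ψ, hψ, rfl⟩ := exists_of_mem_gradientFields hx hc hH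
  refine ⟨ψ, hψ, ?_⟩
  rw [dist_eq_norm] at hd
  have h3 : toField x (grad x fun y => F y + ψ y) =
      -(G - proj x G - toField x (grad x ψ)) - proj x G := by
    rw [toField_grad_add hx hc hF hψ.smoothUpTo, hG, toField_neg_grad hx hc hF]
    abel
  rw [h3]
  calc ‖-(G - proj x G - toField x (grad x ψ)) - proj x G‖
      ≤ ‖-(G - proj x G - toField x (grad x ψ))‖ + ‖proj x G‖ := norm_sub_le _ _
    _ ≤ ε + ‖proj x G‖ := by rw [norm_neg]; gcongr
    _ = _ := add_comm _ _

/-! ### Comparison of the Hilbert space norm with the norms of components. -/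

lemma norm_sq_field (hx : SmoothUpTo x) (hc : CoordinateCondition x c₁) (F : FieldSpace x) :
    ‖F‖ ^ 2 = ∫ y in Om n, kap x y * vsq (F y) := by
  rw [← real_inner_self_eq_norm_sq, L2.inner_def, integral_vol hx hc]
  congr 1; ext y
  rw [real_inner_self_eq_norm_sq, norm_sq_eq_vsq]

lemma integrable_vsq_field (hx : SmoothUpTo x) (hc : CoordinateCondition x c₁)
    (F : FieldSpace x) : IntegrableOn (fun y => vsq (F y)) (Om n) := by
  have h1 : Integrable (fun y => ‖F y‖ ^ 2) (vol x) := (Lp.memLp F).integrable_norm_pow two_ne_zero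
  have h2 : AEStronglyMeasurable (fun y => vsq (F y)) (volume.restrict (Om n)) := by
    have := h1.1.mono_ac (restrict_absolutelyContinuous_vol hx hc)
    simpa only [norm_sq_eq_vsq] using this
  unfold vol at h1
  rw [integrable_withDensity_iff_integrable_smul₀' (aemeasurable_kap hx hc)
    (Filter.Eventually.of_forall fun _ => ENNReal.ofReal_lt_top)] at h1
  refine (h1.const_mul (detBound n c₁)).mono' h2 ?_
  filter_upwards [ae_restrict_mem measurableSet_ball] with y hy
  have hy' := om_subset_omBar hy
  have hk := hc.kap_pos hy'
  rw [ENNReal.toReal_ofReal hk.le, norm_sq_eq_vsq, smul_eq_mul, Real.norm_eq_abs,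
    abs_of_nonneg (vsq_nonneg _), ← mul_assoc]
  refine le_mul_of_one_le_left (vsq_nonneg _) ?_
  have := hc.inv_kap_le hy'
  rwa [← div_le_iff₀ hk, one_div]

lemma normVec_sq (U : Vec n → Vec n) : normVec U ^ 2 = ∫ y in Om n, vsq (U y) :=
  Real.sq_sqrt (integral_nonneg fun _ => vsq_nonneg _)

lemma normMat_sq (T : Vec n → Matrix (Fin n) (Fin n) ℝ) :
    normMat T ^ 2 = ∫ y in Om n, msq (T y) :=
  Real.sq_sqrt (integral_nonneg fun _ => msq_nonneg _)

lemma normFun_sq (f : Vec n → ℝ) : normFun f ^ 2 = ∫ y in Om n, f y ^ 2 :=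
  Real.sq_sqrt (integral_nonneg fun _ => sq_nonneg _)

/-- The norm of the Hilbert space is controlled by the norm of the Lagrangian components. -/
lemma norm_sq_field_le (hx : SmoothUpTo x) (hc : CoordinateCondition x c₁) (F : FieldSpace x) :
    ‖F‖ ^ 2 ≤ detBound n c₁ * (c₁ ^ 2 + 1) * normVec (toLagrange x F) ^ 2 := by
  have hF := integrable_vsq_field hx hc F
  have hFm : AEStronglyMeasurable (fun y => F y) (volume.restrict (Om n)) :=
    (Lp.aestronglyMeasurable F).mono_ac (restrict_absolutelyContinuous_vol hx hc)
  -- Integrability is essential for an upper bound: the integral of a nonintegrable function is 0 by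
  -- convention.
  have hL : IntegrableOn (fun y => vsq (toLagrange x F y)) (Om n) := by
    refine (hF.const_mul (c₁ ^ 2 + 1)).mono' ?_ ?_
    · have e : (fun y => vsq (toLagrange x F y)) =
          fun y => ∑ a, (∑ i, (jac x y)⁻¹ a i * F y i) ^ 2 := rfl
      rw [e]
      refine Finset.aestronglyMeasurable_fun_sum _ fun a _ => AEStronglyMeasurable.pow
        (Finset.aestronglyMeasurable_fun_sum _ fun i _ => ?_) 2
      refine AEStronglyMeasurable.mul (((continuousOn_jac_inv hx hc a i).mono
        om_subset_omBar).aestronglyMeasurable measurableSet_ball) ?_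
      exact (EuclideanSpace.proj (𝕜 := ℝ) i).continuous.comp_aestronglyMeasurable hFm
    · filter_upwards [ae_restrict_mem measurableSet_ball] with y hy
      rw [Real.norm_eq_abs, abs_of_nonneg (vsq_nonneg _)]
      exact (vsq_mulVec _ _).trans (mul_le_mul_of_nonneg_right
        (hc.msq_jac_inv_le (om_subset_omBar hy)) (vsq_nonneg _))
  rw [norm_sq_field hx hc, normVec_sq, ← integral_const_mul]
  refine integral_mono_of_nonneg ?_ (hL.const_mul _) ?_
  · filter_upwards [ae_restrict_mem measurableSet_ball] with y hy
    exact mul_nonneg (hc.kap_pos (om_subset_omBar hy)).le (vsq_nonneg _)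
  · filter_upwards [ae_restrict_mem measurableSet_ball] with y hy
    have hy' := om_subset_omBar hy
    have hu : IsUnit (jac x y).det := isUnit_iff_ne_zero.2 (hc y hy').1
    have e : (F y : Fin n → ℝ) = jac x y *ᵥ (toLagrange x F y) := by
      change (F y : Fin n → ℝ) = jac x y *ᵥ ((jac x y)⁻¹ *ᵥ fun i => F y i)
      rw [Matrix.mulVec_mulVec, Matrix.mul_nonsing_inv _ hu, Matrix.one_mulVec]
    have h1 : vsq (F y) ≤ (c₁ ^ 2 + 1) * vsq (toLagrange x F y) := by
      conv_lhs => rw [e]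
      exact (vsq_mulVec _ _).trans (mul_le_mul_of_nonneg_right (hc.msq_jac_le hy')
        (vsq_nonneg _))
    rw [mul_assoc]
    exact mul_le_mul (hc.kap_le hy') h1 (vsq_nonneg _) (detBound_pos n c₁).le

/-- The gradient of a function is controlled by the norm of its gradient field. -/
lemma integral_vsq_pd_le (hx : SmoothUpTo x) (hc : CoordinateCondition x c₁) {f : Vec n → ℝ}
    (hf : SmoothUpTo f) :
    ∫ y in Om n, vsq (fun a => pd f a y) ≤
      detBound n c₁ * (c₁ ^ 2 + 1) * ‖toField x (grad x f)‖ ^ 2 := by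
  have hG := integrable_vsq_field hx hc (toField x (grad x f))
  have hkap : IntegrableOn (fun y => kap x y * vsq (toField x (grad x f) y)) (Om n) := by
    refine hG.bdd_mul (c := detBound n c₁) (((smoothUpTo_kap hx hc).continuousOn.mono
      om_subset_omBar).aestronglyMeasurable measurableSet_ball) ?_
    filter_upwards [ae_restrict_mem measurableSet_ball] with y hy
    have hy' := om_subset_omBar hy
    rw [Real.norm_eq_abs, abs_of_pos (hc.kap_pos hy')]
    exact hc.kap_le hy'
  rw [norm_sq_field hx hc, ← integral_const_mul]
  refine integral_mono_of_nonneg (Filter.Eventually.of_forall fun y => vsq_nonneg _)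
    (hkap.const_mul _) ?_
  filter_upwards [(restrict_absolutelyContinuous_vol hx hc).ae_le (coeFn_toField_grad hx hc hf)]
    with y hy
  have hy' := om_subset_omBar hy.1
  have hu : IsUnit (jac x y).det := isUnit_iff_ne_zero.2 (hc y hy').1
  have e : (fun a => pd f a y) = (jac x y)ᵀ *ᵥ (toField x (grad x f) y) := by
    rw [hy.2]
    change _ = (jac x y)ᵀ *ᵥ (((jac x y)⁻¹)ᵀ *ᵥ fun b => pd f b y)
    rw [Matrix.mulVec_mulVec, ← Matrix.transpose_mul, Matrix.nonsing_inv_mul _ hu,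
      Matrix.transpose_one, Matrix.one_mulVec]
  have h1 : vsq (fun a => pd f a y) ≤ (c₁ ^ 2 + 1) * vsq (toField x (grad x f) y) := by
    conv_lhs => rw [e]
    refine (vsq_mulVec _ _).trans (mul_le_mul_of_nonneg_right ?_ (vsq_nonneg _))
    rw [msq_transpose]; exact hc.msq_jac_le hy'
  have h2 : 1 ≤ detBound n c₁ * kap x y := by
    have := hc.inv_kap_le hy'
    rwa [← div_le_iff₀ (hc.kap_pos hy'), one_div]
  refine h1.trans ?_
  have h3 : 0 ≤ (c₁ ^ 2 + 1) * vsq (toField x (grad x f) y) :=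
    mul_nonneg (by positivity) (vsq_nonneg _)
  refine (le_mul_of_one_le_left h3 h2).trans (le_of_eq (by ring))

/-- The normal operator controls the gradients of suitable functions with the boundary values
of `(∂_c p) W^c`. -/
lemma exists_test_integral_le (hx : SmoothUpTo x) (hc : CoordinateCondition x c₁)
    {p : Vec n → ℝ} {W : Vec n → Vec n} (hF : SmoothUpTo (along W p)) {ε : ℝ} (hε : 0 < ε) :
    ∃ ψ, IsTest ψ ∧ ∫ y in Om n, vsq (fun a => pd (fun z => along W p z + ψ z) a y) ≤
      2 * (detBound n c₁ * (c₁ ^ 2 + 1)) ^ 2 * normVec (normalOp x p W) ^ 2 + ε := by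
  set c := detBound n c₁ * (c₁ ^ 2 + 1) with hcdef
  have hcpos : 0 < c := mul_pos (detBound_pos n c₁) (by positivity)
  -- The tolerance `√(ε / (2 c))` makes its contribution `c · 2 · ε / (2 c) = ε`.
  obtain ⟨ψ, hψ, h⟩ := exists_test_norm_le hx hc hF
    (Real.sqrt_pos.2 (div_pos hε (mul_pos two_pos hcpos)))
  refine ⟨ψ, hψ, (integral_vsq_pd_le hx hc (hF.add hψ.smoothUpTo)).trans ?_⟩
  set P := proj x (toField x fun y => - grad x (along W p) y) with hP
  have h1 := norm_sq_field_le hx hc P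
  have h2 : ‖toField x (grad x fun y => along W p y + ψ y)‖ ^ 2 ≤
      2 * ‖P‖ ^ 2 + 2 * (ε / (2 * c)) := by
    have hs := Real.sq_sqrt (div_pos hε (mul_pos two_pos hcpos)).le
    have h3 := pow_le_pow_left₀ (norm_nonneg _) h 2
    nlinarith [sq_nonneg (‖P‖ - Real.sqrt (ε / (2 * c)))]
  have h4 : normVec (normalOp x p W) = normVec (toLagrange x P) := rfl
  rw [h4, ← hcdef]
  calc c * ‖toField x (grad x fun y => along W p y + ψ y)‖ ^ 2
      ≤ c * (2 * ‖P‖ ^ 2 + 2 * (ε / (2 * c))) := by gcongr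
    _ = 2 * c * ‖P‖ ^ 2 + ε := by field_simp
    _ ≤ 2 * c * (c * normVec (toLagrange x P) ^ 2) + ε := by gcongr
    _ = _ := by ring

end projection

/-- The integral estimates bound sums of squares, while the theorem is linear in the norms; all
terms being nonnegative, the cross terms only help. -/
lemma sum_sq_le_sq_sum {b A u v w K L G : ℝ} (hb : 0 ≤ b) (hA : 0 ≤ A) (hu : 0 ≤ u) (hv : 0 ≤ v)
    (hw : 0 ≤ w) (hK : 0 ≤ K) (hL : 0 ≤ L) (hG : 0 ≤ G) :
    b * A ^ 2 + K ^ 2 * (u ^ 2 + v ^ 2) + (L ^ 2 + K ^ 2 * G ^ 2) * w ^ 2 ≤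
      (b + 1) * (A + K * (u + v) + (L + K * G) * w) ^ 2 := by
  have h1 : K ^ 2 * (u ^ 2 + v ^ 2) ≤ (K * (u + v)) ^ 2 := by
    rw [mul_pow]
    refine mul_le_mul_of_nonneg_left ?_ (sq_nonneg _)
    linarith [mul_nonneg hu hv]
  have h2 : (L ^ 2 + K ^ 2 * G ^ 2) * w ^ 2 ≤ ((L + K * G) * w) ^ 2 := by
    rw [mul_pow]
    refine mul_le_mul_of_nonneg_right ?_ (sq_nonneg _)
    linarith [mul_nonneg hL (mul_nonneg hK hG)]
  have hX : 0 ≤ K * (u + v) := by positivity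
  have hY : 0 ≤ (L + K * G) * w := by positivity
  generalize K * (u + v) = X at *
  generalize (L + K * G) * w = Y at *
  have h3 : A ^ 2 + X ^ 2 + Y ^ 2 ≤ (A + X + Y) ^ 2 := by
    linarith [mul_nonneg hA hX, mul_nonneg hA hY, mul_nonneg hX hY]
  have h4 : b * A ^ 2 ≤ b * (A + X + Y) ^ 2 :=
    mul_le_mul_of_nonneg_left (by linarith [sq_nonneg X, sq_nonneg Y]) hb
  linarith [sq_nonneg A]

end EulerLagrangian

theorem lemma5p4 (n : ℕ) (c₁ : ℝ) :
    ∃ C : ℝ, 0 < C ∧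
      ∀ (x : Vec n → Vec n) (p : Vec n → ℝ) (W : Vec n → Vec n)
        (d₀ : ℝ) (S₁ : Finset (Vec n → Vec n)) (c₀ K₂ K₃ : ℝ),
        SmoothUpTo x → CoordinateCondition x c₁ →
        SmoothUpTo p → (∀ y ∈ bdry n, p y = 0) →
        SmoothUpTo W →
        0 < d₀ → d₀ < 1 → IsInteriorFamily d₀ S₁ →
        0 < c₀ → (∀ y ∈ bdry n, c₀ ≤ |normalDeriv x p y|) →
        supBdry (normalDeriv x p) ≤ K₂ →
        ∑ S ∈ tangential S₁, supBdry (normalDeriv x (along S p)) ≤ K₃ →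
        c₀ * normMat (partials W) ≤
            C * (normVec (normalOp x p W)
              + K₂ * (normMat (curl (lower x W)) + normFun (divergence x W))
              + (K₃ + K₂ * metricBracket x) * normVec W) ∧
          c₀ * normMat (partials W) ≤
            C * max 1 K₂ * (normVec (normalOp x p W)
              + K₂ * (normMat (curl (lower x W)) + normFun (divergence x W))
              + (K₃ + metricBracket x) * normVec W) := by
  obtain ⟨C, hC, hest⟩ := exists_integral_partials_le n c₁
  set b := 2 * (detBound n c₁ * (c₁ ^ 2 + 1)) ^ 2 with hb
  have hb0 : 0 ≤ b := by positivity
  refine ⟨C * (b + 1) + 1, by positivity, ?_⟩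
  intro x p W d₀ S₁ c₀ K₂ K₃ hx hc hp hp0 hW _ _ _ hc₀ hc₀' hK₂ hK₃
  have hK₂0 : 0 ≤ K₂ := (supBdry_nonneg _).trans hK₂
  have hK₃0 : 0 ≤ K₃ := (Finset.sum_nonneg fun _ _ => supBdry_nonneg _).trans hK₃
  have hG : 1 ≤ metricBracket x := one_le_metricBracket
  have hN : ∀ {r : ℝ}, 0 ≤ Real.sqrt r := Real.sqrt_nonneg _
  have hA : 0 ≤ normVec (normalOp x p W) := hN
  have hcu : 0 ≤ normMat (curl (lower x W)) := hN
  have hdv : 0 ≤ normFun (divergence x W) := hN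
  have hw : 0 ≤ normVec W := hN
  have hD : 0 ≤ normMat (partials W) := hN
  have key : c₀ ^ 2 * normMat (partials W) ^ 2 ≤ C * (b * normVec (normalOp x p W) ^ 2 +
      K₂ ^ 2 * (normMat (curl (lower x W)) ^ 2 + normFun (divergence x W) ^ 2) +
      (K₃ ^ 2 + K₂ ^ 2 * metricBracket x ^ 2) * normVec W ^ 2) := by
    -- The constants in front do not depend on the test function `ψ`, so the approximation error can
    -- be sent to zero.
    refine le_of_forall_pos_le_add fun ε hε => ?_
    obtain ⟨ψ, hψ, hψe⟩ := exists_test_integral_le hx hc (smoothUpTo_along hW hp)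
      (div_pos hε hC)
    have h := hest x p W S₁ c₀ K₂ K₃ ψ hx hc hp hp0 hW hc₀ hc₀' hK₂ hK₃ hψ.smoothUpTo
      fun y hy => hψ.eq_zero_of_mem_bdry hy
    rw [← normMat_sq, ← normMat_sq, ← normFun_sq, ← normVec_sq] at h
    refine h.trans ?_
    calc _ ≤ C * ((b * normVec (normalOp x p W) ^ 2 + ε / C) +
          K₂ ^ 2 * (normMat (curl (lower x W)) ^ 2 + normFun (divergence x W) ^ 2) +
          (K₃ ^ 2 + K₂ ^ 2 * metricBracket x ^ 2) * normVec W ^ 2) := by gcongr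
      _ = _ := by field_simp; ring
  set A := normVec (normalOp x p W)
  set cu := normMat (curl (lower x W))
  set dv := normFun (divergence x W)
  set w := normVec W
  set G := metricBracket x
  have first : c₀ * normMat (partials W) ≤
      (C * (b + 1) + 1) * (A + K₂ * (cu + dv) + (K₃ + K₂ * G) * w) := by
    refine (sq_le_sq₀ (by positivity) (by positivity)).1 ?_
    have h1 := sum_sq_le_sq_sum hb0 hA hcu hdv hw hK₂0 hK₃0 (zero_le_one.trans hG)
    -- The added 1 in the final constant replaces taking a square root of `C * (b + 1)`.
    have h2 : C * (b + 1) ≤ (C * (b + 1) + 1) ^ 2 := by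
      have : 0 ≤ C * (b + 1) := by positivity
      nlinarith
    rw [mul_pow, mul_pow]
    calc c₀ ^ 2 * normMat (partials W) ^ 2 ≤ _ := key
      _ ≤ C * ((b + 1) * (A + K₂ * (cu + dv) + (K₃ + K₂ * G) * w) ^ 2) := by gcongr
      _ = C * (b + 1) * (A + K₂ * (cu + dv) + (K₃ + K₂ * G) * w) ^ 2 := by ring
      _ ≤ _ := by gcongr
  refine ⟨first, first.trans ?_⟩
  rw [mul_assoc (C * (b + 1) + 1)]
  refine mul_le_mul_of_nonneg_left ?_ (by positivity)
  set m := max 1 K₂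
  have hm1 : 1 ≤ m := le_max_left _ _
  have hmK : K₂ ≤ m := le_max_right _ _
  have f1 : A + K₂ * (cu + dv) ≤ m * (A + K₂ * (cu + dv)) :=
    le_mul_of_one_le_left (by positivity) hm1
  have f2 : (K₃ + K₂ * G) * w ≤ (m * K₃ + m * G) * w := by
    gcongr
    exact le_mul_of_one_le_left hK₃0 hm1
  calc _ ≤ m * (A + K₂ * (cu + dv)) + (m * K₃ + m * G) * w := add_le_add f1 f2
    _ = _ := by ring
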